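/- **Setting.** A concurrent miner with $n$ threads executes a list of atomic-units (AUs), i.e. programs of reads and writes of shared objects and local steps. Each thread repeatedly takes the next AU from a shared counter and runs it as a transaction with a fresh unique timestamp $i\ge 1$ (the transaction is denoted $T_i$); whenever the transaction aborts, the AU is run again as a new transaction. Reads $r_i(x)$ and commit attempts $tryC_i$ are atomic operations of a software transactional memory that follows one of two protocols; writes are kept in a local log until the commit, and a read of an object that $T_i$ has itself already written is served from this log. * *BTO* (basic timestamp ordering, one version per object): $r_i(x)$ aborts iff a transaction with a larger timestamp has committed a write of $x$; $tryC_i$ aborts iff some object written by $T_i$ has been read, or overwritten by a commit, by a transaction with a larger timestamp. * *MVTO* (multi-version timestamp ordering): $r_i(x)$ returns the version of $x$ with the largest timestamp below $i$ (version $0$ is the initial value); $tryC_i$ aborts iff, for some object $x$ written by $T_i$, the version of $x$ with the largest timestamp below $i$ has been read by a transaction with a timestamp larger than $i$; otherwise a version with timestamp $i$ is added for each object that $T_i$ writes. At a successful $tryC_i$ the transactional memory records the conflict list of $T_i$: all transactions already committed then that wrote an object that $T_i$ reads or writes, or read an object that $T_i$ writes. The thread then, for each $j$ in this list, calls $addVert(j)$,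 $addVert(i)$, and $addEdge$ from the one of $i,j$ with the smaller timestamp to the other. The block graph (BG) is an adjacency list of sorted linked lists in shared memory; $addVert$ and $addEdge$ search for the position of a timestamp by following next pointers, return if it is present, and otherwise insert a new node by a compare-and-swap on the next pointer of the predecessor, searching on from the predecessor when this fails. Steps of different threads (single shared-memory accesses, operations of the transactional memory) interleave arbitrarily. In the history $H$ of operations executed so far, for distinct $k,m$, $T_k\prec T_m$ means: $tryC_k$ precedes $tryC_m$, both successful, and both transactions write a common object; or a successful $tryC_k$ precedes a successful read $r_m(x)$ of an object $x$ written by $T_k$; or a successful read $r_k(x)$ precedes a successful $tryC_m$ and $T_m$ writes $x$. Committed $T_i,T_j$ are *in conflict* if $T_i\prec T_j$ or $T_j\prec T_i$. For committed $T_k, T_m$ with $k\neq m$, there is a *dependency* $T_k\to T_m$ if: under BTO, $T_k\prec T_m$; under MVTO, $T_m$ reads a version written by $T_k$, or both write a common object and $k<m$, or $T_k$ reads a version $j$ of an object written by $T_m$ with $j<m$. **Theorem 3.** Under BTO and under MVTO, in every reachable state of the miner: 1. every vertex of the BG is the timestamp of a committed transaction and carries the identifier of the AU which that transaction executes; 2.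 every edge of the BG from $i$ to $j$ satisfies $i<j$, refers to a vertex of the BG with timestamp $j$, and joins two conflicting committed transactions; 3. if the committed transactions $T_i,T_j$ are in conflict, and no thread is still processing the conflict list of $T_i$ or $T_j$, then the BG contains the edge from $\min(i,j)$ to $\max(i,j)$; 4. if there is a dependency $T_k\to T_m$, and no thread is still processing the conflict list of $T_k$ or $T_m$, then $k<m$ and the BG contains the edge from $k$ to $m$. In particular, when all threads have finished, the BG has an edge from $i$ to $j$ if and only if $i<j$ and $T_i,T_j$ are committed and in conflict. -/

import Mathlib

universe u v

/-! ### Lock-free sorted linked lists -/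

/-- Keys of list nodes: a timestamp, or `-∞` / `+∞` for the two sentinels. -/
abbrev Key : Type := WithBot (WithTop ℕ)

/-- The key of a proper (non-sentinel) node. -/
def tsKey (i : ℕ) : Key := ((i : WithTop ℕ) : WithBot (WithTop ℕ))

/-- A node of a linked list in shared memory: its (immutable) key, the address of the next node,
and a payload. -/
structure ListNode (α : Type) where
  key : Key
  next : ℕ
  data : α

/-- The memory of a linked list.  The addresses below `size` are allocated; address `0` is the
head sentinel and address `1` is the tail sentinel. -/
structure LockFreeList (α : Type) where
  node : ℕ → ListNode α
  size : ℕ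

/-- The list that consists of the two sentinels (`d` is an irrelevant payload for them). -/
def LockFreeList.empty {α : Type} (d : α) : LockFreeList α where
  node a := if a = 0 then ⟨⊥, 1, d⟩ else ⟨⊤, 1, d⟩
  size := 2

/-- `l.Linked a`: the node at address `a` can be reached from the head sentinel by following
`next` pointers. -/
def LockFreeList.Linked {α : Type} (l : LockFreeList α) (a : ℕ) : Prop :=
  Relation.ReflTransGen (fun b c => (l.node b).next = c) 0 a

/-- The pair `⟨pred, curr⟩` that a thread keeps while it looks for the position of a key;
`curr = none` means that `pred.next` still has to be read. -/
structure Window where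
  pred : ℕ
  curr : Option ℕ

/-- The window with which a search starts: `pred` is the head sentinel. -/
def Window.start : Window := ⟨0, none⟩

/-- Result of one step of an insertion: it goes on with a new window, or returns
"already present" or "added", together with the address of the node. -/
inductive InsertResult where
  | again (w : Window)
  | present (a : ℕ)
  | added (a : ℕ)

/-- The compare-and-swap `pred.next.CAS(curr, new)`, where `new` is a newly allocated node with key
`k`, payload `d` and next pointer `curr`.  A new node is private to its thread until the swap
publishes it, so it is allocated in the step of a successful swap. -/
def LockFreeList.cas {α : Type} (l : LockFreeList α) (pred curr : ℕ) (k : Key) (d : α) :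
    LockFreeList α × InsertResult :=
  if (l.node pred).next = curr then
    ({ node := Function.update
        (Function.update l.node pred { l.node pred with next := l.size }) l.size ⟨k, curr, d⟩
       size := l.size + 1 }, .added l.size)
  else (l, .again ⟨pred, none⟩)

/-- One atomic step of the lock-free insertion of the key `k` with payload `d`: read `pred.next`;
or, once `curr` is known, move on if `curr.key < k`, return "already present" if `curr.key = k`,
and otherwise try the compare-and-swap, starting again from `pred` if it fails. -/
def LockFreeList.insertStep {α : Type} (l : LockFreeList α) (k : Key) (d : α) (w : Window) :
    LockFreeList α × InsertResult :=
  match w.curr with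
  | none => (l, .again ⟨w.pred, some (l.node w.pred).next⟩)
  | some c =>
    if (l.node c).key < k then (l, .again ⟨c, none⟩)
    else if (l.node c).key = k then (l, .present c)
    else l.cas w.pred c k d

/-- Overwrites the payload of the node at address `a`. -/
def LockFreeList.setData {α : Type} (l : LockFreeList α) (a : ℕ) (d : α) : LockFreeList α :=
  { l with node := Function.update l.node a { l.node a with data := d } }

/-! ### The block graph -/

/-- Payload of an edge node: the address of the vertex node of the target. -/
structure EdgeData where
  vref : ℕ

/-- Payload of a vertex node: identifier of the atomic-unit, in-degree counter, edge list. -/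
structure VertexData where
  auId : ℕ
  inCnt : ℕ
  edges : LockFreeList EdgeData

/-- The block graph is an adjacency list: the vertex list, each node of which holds its own
edge list. -/
abbrev BlockGraph : Type := LockFreeList VertexData

/-- Payload of a newly created vertex node. -/
def VertexData.new (au : ℕ) : VertexData := ⟨au, 0, LockFreeList.empty ⟨0⟩⟩

/-- The block graph without vertices. -/
def BlockGraph.initial : BlockGraph := LockFreeList.empty (VertexData.new 0)

/-- One atomic step of `addVert(i)` (`au` is the atomic-unit executed by `T_i`). -/
def BlockGraph.addVertStep (G : BlockGraph) (i au : ℕ) (w : Window) : BlockGraph × InsertResult :=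
  G.insertStep (tsKey i) (VertexData.new au) w

/-- One atomic step of `addEdge(fromNode, toNode)`, where the nodes are given by their addresses
`a` and `b` in the vertex list: insertion of `toNode.ts` into the edge list of `fromNode`. -/
def BlockGraph.addEdgeStep (G : BlockGraph) (a b : ℕ) (w : Window) : BlockGraph × InsertResult :=
  let r := (G.node a).data.edges.insertStep (G.node b).key ⟨b⟩ w
  (G.setData a { (G.node a).data with edges := r.1 }, r.2)

/-- The atomic increment of the in-degree counter of the vertex node at address `b`. -/
def BlockGraph.incInCnt (G : BlockGraph) (b : ℕ) : BlockGraph :=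
  G.setData b { (G.node b).data with inCnt := (G.node b).data.inCnt + 1 }

/-- The node at address `a` of the vertex list is a vertex of the graph, with timestamp `i`. -/
def BlockGraph.VertexAt (G : BlockGraph) (a i : ℕ) : Prop :=
  G.Linked a ∧ (G.node a).key = tsKey i

/-- The node at address `e` of the edge list of the vertex node `a` is an edge, to timestamp
`j`. -/
def BlockGraph.EdgeAt (G : BlockGraph) (a e j : ℕ) : Prop :=
  (G.node a).data.edges.Linked e ∧ ((G.node a).data.edges.node e).key = tsKey j

/-- The vertex node to which the edge node `e` in the edge list of the vertex node `a` refers. -/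
def BlockGraph.target (G : BlockGraph) (a e : ℕ) : ℕ :=
  ((G.node a).data.edges.node e).data.vref

/-- The block graph contains an edge from timestamp `i` to timestamp `j`: the edge list of a
vertex with timestamp `i` contains an edge node for `j` that refers to a vertex with
timestamp `j`. -/
def BlockGraph.HasEdge (G : BlockGraph) (i j : ℕ) : Prop :=
  ∃ a e, G.VertexAt a i ∧ G.EdgeAt a e j ∧ G.VertexAt (G.target a e) j

/-! ### Transactional memory: the two protocols

A transaction is identified with its timestamp.  Timestamp `0` belongs to the transaction that
initializes all objects.  Every operation of the transactional memory is one atomic event. -/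

/-- The shared part of a software transactional memory: its state, and the operations
`read_i(x)` (which returns `none` for an abort, and otherwise the timestamp of the transaction
that wrote the version that is read, and its value) and `tryC_i` for the write log of
`T_i` (which returns whether `T_i` commits). -/
structure STM (Obj : Type u) (Val : Type v) where
  State : Type (max u v)
  initial : State
  read : State → ℕ → Obj → State × Option (ℕ × Val)
  tryC : State → ℕ → List (Obj × Val) → State × Bool

/-- The set of objects in a write log. -/
def writeSet {Obj : Type u} {Val : Type v} [DecidableEq Obj] (wlog : List (Obj × Val)) :
    Finset Obj :=
  (wlog.map Prod.fst).toFinset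

/-- Basic timestamp ordering keeps, for each object, a single version, with the timestamp of its
writer, and the largest timestamp of a transaction that has read the object. -/
structure BTOCell (Val : Type v) where
  val : Val
  maxR : ℕ
  maxW : ℕ

/-- Basic timestamp ordering: an operation is rejected iff it comes too late, that is, iff a
conflicting operation of a younger transaction was executed before. Writes take effect
at the commit. -/
def bto {Obj : Type u} {Val : Type v} [DecidableEq Obj] (x₀ : Obj → Val) : STM Obj Val where
  State := ULift.{u} (Obj → BTOCell Val)
  initial := ⟨fun x => ⟨x₀ x, 0, 0⟩⟩
  read := fun σ i x =>
    if i < (σ.down x).maxW then (σ, none)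
    else (⟨Function.update σ.down x { σ.down x with maxR := max (σ.down x).maxR i }⟩,
      some ((σ.down x).maxW, (σ.down x).val))
  tryC := fun σ i wlog =>
    if ∃ x ∈ writeSet wlog, i < (σ.down x).maxR ∨ i < (σ.down x).maxW then (σ, false)
    else (⟨fun x => match wlog.lookup x with
      | some w => { σ.down x with val := w, maxW := i }
      | none => σ.down x⟩, true)

/-- Multi-version timestamp ordering keeps, for each object, the timestamps of its versions, and
for each version its value and the set of transactions that have read it. -/
structure MVTOCell (Val : Type v) where
  versions : Finset ℕ
  val : ℕ → Val
  readers : ℕ → Finset ℕ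

/-- The latest version that is older than `T_i`. -/
def MVTOCell.latest {Val : Type v} (c : MVTOCell Val) (i : ℕ) : ℕ :=
  (c.versions.filter (· < i)).sup id

/-- Multi-version timestamp ordering: `T_i` reads the latest version older than itself, and it is
aborted at its commit iff, for an object that it writes, the latest version older than `T_i` was
read by a transaction younger than `T_i`. -/
def mvto {Obj : Type u} {Val : Type v} [DecidableEq Obj] (x₀ : Obj → Val) : STM Obj Val where
  State := ULift.{u} (Obj → MVTOCell Val)
  initial := ⟨fun x => ⟨{0}, fun _ => x₀ x, fun _ => ∅⟩⟩
  read := fun σ i x =>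
    let c := σ.down x
    let j := c.latest i
    (⟨Function.update σ.down x
        { c with readers := Function.update c.readers j (insert i (c.readers j)) }⟩,
      some (j, c.val j))
  tryC := fun σ i wlog =>
    if ∃ x ∈ writeSet wlog, ∃ k ∈ (σ.down x).readers ((σ.down x).latest i), i < k then (σ, false)
    else (⟨fun x => match wlog.lookup x with
      | some w => { σ.down x with
          versions := insert i (σ.down x).versions
          val := Function.update (σ.down x).val i w }
      | none => σ.down x⟩, true)

/-- The two protocols. -/
inductive Protocol where
  | BTO
  | MVTO

/-- The transactional memory of a protocol; `x₀` are the initial values of the objects. -/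
def Protocol.stm {Obj : Type u} {Val : Type v} [DecidableEq Obj] (P : Protocol) (x₀ : Obj → Val) :
    STM Obj Val :=
  match P with
  | .BTO => bto x₀
  | .MVTO => mvto x₀

/-- The conflict lists that the transactional memory maintains: for each object the committed
transactions that have read it and that have written it, and for each committed transaction
its conflict list. -/
structure ConflictTable (Obj : Type u) where
  readersOf : Obj → Finset ℕ
  writersOf : Obj → Finset ℕ
  confList : ℕ → Finset ℕ

/-- No transaction has committed yet. -/
def ConflictTable.initial (Obj : Type u) : ConflictTable Obj := ⟨fun _ => ∅, fun _ => ∅, fun _ => ∅⟩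

/-- The update of the conflict lists by the successful `tryC_i` of a transaction with the given
read and write sets. -/
def ConflictTable.commit {Obj : Type u} [DecidableEq Obj] (c : ConflictTable Obj) (i : ℕ)
    (rset wset : Finset Obj) : ConflictTable Obj where
  readersOf x := if x ∈ rset then insert i (c.readersOf x) else c.readersOf x
  writersOf x := if x ∈ wset then insert i (c.writersOf x) else c.writersOf x
  confList := Function.update c.confList i
    (rset.biUnion c.writersOf ∪ wset.biUnion fun x => c.writersOf x ∪ c.readersOf x)

/-! ### Histories, conflicts and dependencies -/

/-- The events of a history.  In `read i x r`, `r = none` stands for an abort, and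
`r = some (j, v)` says that `T_i` reads from `T_j` the value `v`; in `tryC i b`, `b` says
whether `T_i` commits; `beginTx i au` starts `T_i`, which executes the atomic-unit number `au`. -/
inductive Event (Obj : Type u) (Val : Type v) where
  | beginTx (i au : ℕ)
  | read (i : ℕ) (x : Obj) (r : Option (ℕ × Val))
  | write (i : ℕ) (x : Obj) (w : Val)
  | tryC (i : ℕ) (b : Bool)

section History

variable {Obj : Type u} {Val : Type v}

/-- `T_i` is committed in the history `H`. -/
def Committed (H : List (Event Obj Val)) (i : ℕ) : Prop := Event.tryC i true ∈ H

/-- `T_i` writes the object `x` in `H`. -/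
def Writes (H : List (Event Obj Val)) (i : ℕ) (x : Obj) : Prop := ∃ w, Event.write i x w ∈ H

/-- `e` precedes `f` in `H`. -/
def Precedes (H : List (Event Obj Val)) (e f : Event Obj Val) : Prop := List.Sublist [e, f] H

/-- The conflict order `T_k ≺ T_m` of a history, on distinct transactions. -/
def ConflictOrder (H : List (Event Obj Val)) (k m : ℕ) : Prop :=
  k ≠ m ∧
    ((Precedes H (.tryC k true) (.tryC m true) ∧ ∃ x, Writes H k x ∧ Writes H m x) ∨
     (∃ x r, Precedes H (.tryC k true) (.read m x (some r)) ∧ Writes H k x) ∨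
     (∃ x r, Precedes H (.read k x (some r)) (.tryC m true) ∧ Writes H m x))

/-- Two committed transactions are in conflict. -/
def Conflicting (H : List (Event Obj Val)) (i j : ℕ) : Prop :=
  Committed H i ∧ Committed H j ∧ (ConflictOrder H i j ∨ ConflictOrder H j i)

/-- The multi-version dependencies `T_k → T_m` of a history, on distinct transactions, for the
version order given by the timestamps: `T_m` reads from `T_k`; or `T_k` writes an earlier
version of an object than `T_m`; or `T_k` reads a version of an object that is earlier than the
version that `T_m` writes. -/
def MVDependency (H : List (Event Obj Val)) (k m : ℕ) : Prop :=
  k ≠ m ∧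
    ((∃ x w, Event.read m x (some (k, w)) ∈ H) ∨
     (∃ x, Writes H k x ∧ Writes H m x ∧ k < m) ∨
     (∃ x j w, Event.read k x (some (j, w)) ∈ H ∧ Writes H m x ∧ j < m))

/-- In the serialization order of the protocol, the committed transaction `T_m` depends on the
committed transaction `T_k`. -/
def Dependency (P : Protocol) (H : List (Event Obj Val)) (k m : ℕ) : Prop :=
  Committed H k ∧ Committed H m ∧
    match P with
    | .BTO => ConflictOrder H k m
    | .MVTO => MVDependency H k m

end History

/-! ### The concurrent miner -/

/-- An atomic-unit: a program of reads, writes and local steps, in which each step may depend on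
the values read so far. -/
inductive AtomicUnit (Obj : Type u) (Val : Type v) where
  | ret
  | read (x : Obj) (next : Val → AtomicUnit Obj Val)
  | write (x : Obj) (w : Val) (next : AtomicUnit Obj Val)
  | skip (next : AtomicUnit Obj Val)

/-- The local state of a thread of the miner. -/
inductive ThreadState (Obj : Type u) (Val : Type v) where
  /-- about to take the next atomic-unit -/
  | fetch
  /-- about to begin a transaction for the atomic-unit number `au` with program `prog` -/
  | beginTx (au : ℕ) (prog : AtomicUnit Obj Val)
  /-- executing `T_i`; `cont` is the rest of the program -/
  | exec (au : ℕ) (prog : AtomicUnit Obj Val) (i : ℕ) (cont : AtomicUnit Obj Val)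
      (rset : Finset Obj) (wlog : List (Obj × Val))
  /-- `T_i` has committed; about to get its conflict list -/
  | committed (i : ℕ)
  /-- in the loop over the conflict list of `T_i` -/
  | loop (i : ℕ) (todo : List ℕ)
  /-- in `addVert(j)` -/
  | addVertJ (i j : ℕ) (todo : List ℕ) (w : Window)
  /-- in `addVert(i)`; `aj` is the address of the vertex node of `j` -/
  | addVertI (i j : ℕ) (todo : List ℕ) (aj : ℕ) (w : Window)
  /-- in `addEdge` from the vertex node `a` to the vertex node `b` -/
  | addEdge (i j : ℕ) (todo : List ℕ) (a b : ℕ) (w : Window)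
  /-- in `addEdge`, edge added; about to increment the in-degree counter of the vertex node `b` -/
  | incCnt (i j : ℕ) (todo : List ℕ) (b : ℕ)
  /-- no atomic-unit is left -/
  | finished

/-- The committed transaction whose conflicts the thread is adding to the block graph. -/
def ThreadState.building? {Obj : Type u} {Val : Type v} : ThreadState Obj Val → Option ℕ
  | .fetch => none
  | .beginTx _ _ => none
  | .exec _ _ _ _ _ _ => none
  | .committed i => some i
  | .loop i _ => some i
  | .addVertJ i _ _ _ => some i
  | .addVertI i _ _ _ _ => some i
  | .addEdge i _ _ _ _ _ => some i
  | .incCnt i _ _ _ => some i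
  | .finished => none

/-- The global state of a miner with `n` threads. -/
structure Miner {Obj : Type u} {Val : Type v} (M : STM Obj Val) (n : ℕ) where
  /-- state of the transactional memory -/
  tm : M.State
  /-- conflict lists in the transactional memory -/
  table : ConflictTable Obj
  /-- the next timestamp -/
  clock : ℕ
  /-- index of the next atomic-unit -/
  curInd : ℕ
  /-- the atomic-unit executed by a transaction -/
  auOf : ℕ → ℕ
  graph : BlockGraph
  thread : Fin n → ThreadState Obj Val
  /-- the history generated so far -/
  hist : List (Event Obj Val)

namespace Miner

variable {Obj : Type u} {Val : Type v} {M : STM Obj Val} {n : ℕ}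

/-- The initial state. -/
def initial (M : STM Obj Val) (n : ℕ) : Miner M n where
  tm := M.initial
  table := ConflictTable.initial Obj
  clock := 1
  curInd := 0
  auOf := fun _ => 0
  graph := BlockGraph.initial
  thread := fun _ => .fetch
  hist := []

/-- Sets the local state of the thread `t`. -/
def goto (s : Miner M n) (t : Fin n) (p : ThreadState Obj Val) : Miner M n :=
  { s with thread := Function.update s.thread t p }

/-- A step of the thread `t`, which executes `T_i`.  A read of an object that `T_i` has
itself written is served from its write log, without access to the shared object. -/
def execStep [DecidableEq Obj] (s : Miner M n) (t : Fin n) (au : ℕ) (prog : AtomicUnit Obj Val)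
    (i : ℕ) (cont : AtomicUnit Obj Val) (rset : Finset Obj) (wlog : List (Obj × Val)) :
    Miner M n :=
  match cont with
  | .skip next => s.goto t (.exec au prog i next rset wlog)
  | .write x w next =>
    { s with hist := s.hist ++ [Event.write i x w] }.goto t (.exec au prog i next rset ((x, w) :: wlog))
  | .read x next =>
    match wlog.lookup x with
    | some w => s.goto t (.exec au prog i (next w) rset wlog)
    | none =>
      let r := M.read s.tm i x
      { s with tm := r.1, hist := s.hist ++ [Event.read i x r.2] }.goto t
        (match r.2 with
          | none => .beginTx au prog
          | some (_, w) => .exec au prog i (next w) (insert x rset) wlog)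
  | .ret =>
    let r := M.tryC s.tm i wlog
    if r.2 then
      { s with
        tm := r.1
        table := s.table.commit i rset (writeSet wlog)
        hist := s.hist ++ [Event.tryC i true] }.goto t (.committed i)
    else
      { s with tm := r.1, hist := s.hist ++ [Event.tryC i false] }.goto t (.beginTx au prog)

/-- One atomic step of the thread `t`. -/
def step [DecidableEq Obj] (aus : List (AtomicUnit Obj Val)) (s : Miner M n) (t : Fin n) :
    Miner M n :=
  match s.thread t with
  | .fetch =>
    { s with curInd := s.curInd + 1 }.goto t
      (match aus[s.curInd]? with
        | some prog => .beginTx s.curInd prog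
        | none => .finished)
  | .beginTx au prog =>
    { s with
      clock := s.clock + 1
      auOf := Function.update s.auOf s.clock au
      hist := s.hist ++ [Event.beginTx s.clock au] }.goto t (.exec au prog s.clock prog ∅ [])
  | .exec au prog i cont rset wlog => s.execStep t au prog i cont rset wlog
  | .committed i =>
    s.goto t
      (if s.table.confList i = ∅ then .fetch
        else .loop i ((s.table.confList i).sort (· ≤ ·)))
  | .loop _ [] => s.goto t .fetch
  | .loop i (j :: todo) => s.goto t (.addVertJ i j todo Window.start)
  | .addVertJ i j todo w =>
    let r := s.graph.addVertStep j (s.auOf j) w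
    { s with graph := r.1 }.goto t
      (match r.2 with
        | .again w' => .addVertJ i j todo w'
        | .present a => .addVertI i j todo a Window.start
        | .added a => .addVertI i j todo a Window.start)
  | .addVertI i j todo aj w =>
    let r := s.graph.addVertStep i (s.auOf i) w
    let enter := fun a : ℕ =>
      if j < i then ThreadState.addEdge (Obj := Obj) (Val := Val) i j todo aj a Window.start
      else ThreadState.addEdge i j todo a aj Window.start
    { s with graph := r.1 }.goto t
      (match r.2 with
        | .again w' => .addVertI i j todo aj w'
        | .present a => enter a
        | .added a => enter a)
  | .addEdge i j todo a b w =>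
    let r := s.graph.addEdgeStep a b w
    { s with graph := r.1 }.goto t
      (match r.2 with
        | .again w' => .addEdge i j todo a b w'
        | .present _ => .loop i todo
        | .added _ => .incCnt i j todo b)
  | .incCnt i _ todo b => { s with graph := s.graph.incInCnt b }.goto t (.loop i todo)
  | .finished => s

/-- The states that the miner can reach on the list `aus` of atomic-units, under an arbitrary
interleaving of the steps of its threads. -/
inductive Reachable [DecidableEq Obj] (aus : List (AtomicUnit Obj Val)) : Miner M n → Prop where
  | initial : Reachable aus (Miner.initial M n)
  | step {s : Miner M n} (t : Fin n) : Reachable aus s → Reachable aus (s.step aus t)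

/-- Some thread is still adding the conflicts of the committed transaction `T_i` to the graph. -/
def Building (s : Miner M n) (i : ℕ) : Prop := ∃ t, (s.thread t).building? = some i

/-- All threads have finished. -/
def Finished (s : Miner M n) : Prop := ∀ t, s.thread t = .finished

end Miner

/-! ### Precedence, accesses and conflicts in histories. -/

section HistoryLemmas

variable {Obj : Type u} {Val : Type v}

/-! The proof combines an invariant of the history, an invariant of the graph and an invariant of
the protocol, each preserved by every atomic step.

History: up to exchanging the two transactions, the order inside `ConflictOrder` carries no
information, because distinct events of a list are comparable. Thus `Conflicting` is the symmetric
relation `AccessConflict` (`conflicting_iff_accessConflict`). The table records the accesses of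
committed transactions, so the list fixed at the commit of `T_i` consists exactly of its access
conflicts with transactions committed earlier. Of two conflicting transactions, the later committer
therefore lists the other (`HistoryInvariant.append_commit`).

Graph: a successful compare-and-swap splices a fresh node between a linked node and its current
successor, so no linked node is lost or relabelled (`LockFreeList.cas_spec`). What a thread knows
about linked nodes hence survives all steps of other threads. Neither sortedness nor uniqueness of
keys is needed: an insertion ends at a linked node with the requested key, found or created.
Completeness is bookkeeping (`GraphInvariant.complete`): each entry of a conflict list is already an
edge, or is `Pending` in some thread. A transaction that no thread is building has nothing pending.

Direction: the miner orients edges by timestamps, so it remains to see that the protocols order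
dependencies by timestamps (`Protocol.exists_isInvariant`). Under BTO the counters bound all earlier
conflicting accesses, and late operations are rejected. Under MVTO, if `T_k` has read version `j`,
no version lies strictly between `j` and `k`; a commit that would insert one is aborted by its test
(`MVTOInvariant.append_tryC_true`). -/

/-- The transaction to which an event belongs. -/
def Event.tx : Event Obj Val → ℕ
  | .beginTx i _ => i
  | .read i _ _ => i
  | .write i _ _ => i
  | .tryC i _ => i

/-- `T_i` successfully reads the object `x` in `H`. -/
def Reads (H : List (Event Obj Val)) (i : ℕ) (x : Obj) : Prop :=
  ∃ r, Event.read i x (some r) ∈ H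

/-- Two distinct committed transactions access a common object, and one of them writes it. -/
structure AccessConflict (H : List (Event Obj Val)) (i j : ℕ) : Prop where
  ne : i ≠ j
  left : Committed H i
  right : Committed H j
  access : ∃ x, (Writes H i x ∧ Writes H j x) ∨ (Writes H i x ∧ Reads H j x) ∨
    (Reads H i x ∧ Writes H j x)

theorem AccessConflict.symm {H : List (Event Obj Val)} {i j : ℕ} (h : AccessConflict H i j) :
    AccessConflict H j i := by
  obtain ⟨hne, hi, hj, x, h⟩ := h
  exact ⟨hne.symm, hj, hi, x, by tauto⟩

theorem Precedes.mem_left {H : List (Event Obj Val)} {e f : Event Obj Val}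
    (h : Precedes H e f) : e ∈ H := List.Sublist.subset h (by simp)

theorem Precedes.mem_right {H : List (Event Obj Val)} {e f : Event Obj Val}
    (h : Precedes H e f) : f ∈ H := List.Sublist.subset h (by simp)

theorem precedes_total {H : List (Event Obj Val)} {e f : Event Obj Val} (he : e ∈ H)
    (hf : f ∈ H) (hne : e ≠ f) : Precedes H e f ∨ Precedes H f e := by
  obtain ⟨s, t, rfl⟩ := List.append_of_mem he
  simp only [List.mem_append, List.mem_cons, hne.symm, false_or] at hf
  rcases hf with hf | hf
  · right
    exact (List.singleton_sublist.2 hf).append (List.singleton_sublist.2 List.mem_cons_self)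
  · left
    exact ((List.singleton_sublist.2 hf).cons_cons e).trans (List.sublist_append_right _ _)

theorem precedes_append_singleton {H : List (Event Obj Val)} {e f g : Event Obj Val}
    (h : Precedes (H ++ [g]) e f) : Precedes H e f ∨ (e ∈ H ∧ f = g) := by
  obtain ⟨l₁, l₂, hl, h₁, h₂⟩ := List.sublist_append_iff.1 h
  rcases List.sublist_singleton.1 h₂ with rfl | rfl
  · left
    rw [List.append_nil] at hl
    rw [← hl] at h₁
    exact h₁
  · right
    have : l₁ = [e] ∧ f = g := by
      match l₁, hl with
      | [], hl => simp at hl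
      | [a], hl => simp at hl; simp [hl]
      | a :: b :: l, hl => simp at hl
    obtain ⟨rfl, rfl⟩ := this
    exact ⟨by simpa using h₁, rfl⟩

/-- Any two accesses of distinct transactions can be compared through the commit of a writer, and
either outcome is one of the clauses of `ConflictOrder`, in one direction or the other. The
order-free form is what the conflict lists compute. -/
theorem conflicting_iff_accessConflict {H : List (Event Obj Val)} {i j : ℕ} :
    Conflicting H i j ↔ AccessConflict H i j := by
  constructor
  · rintro ⟨hi, hj, h⟩
    have key : ∀ k m, Committed H k → Committed H m → ConflictOrder H k m →
        AccessConflict H k m := by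
      rintro k m hk hm ⟨hne, ⟨-, x, h⟩ | ⟨x, r, h, hw⟩ | ⟨x, r, h, hw⟩⟩
      · exact ⟨hne, hk, hm, x, .inl h⟩
      · exact ⟨hne, hk, hm, x, .inr (.inl ⟨hw, r, h.mem_right⟩)⟩
      · exact ⟨hne, hk, hm, x, .inr (.inr ⟨⟨r, h.mem_left⟩, hw⟩)⟩
    rcases h with h | h
    · exact key i j hi hj h
    · exact (key j i hj hi h).symm
  · rintro ⟨hne, hi, hj, x, h⟩
    refine ⟨hi, hj, ?_⟩
    rcases h with ⟨h₁, h₂⟩ | ⟨h₁, r, h₂⟩ | ⟨⟨r, h₁⟩, h₂⟩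
    · rcases precedes_total hi hj (by simpa using hne) with h | h
      · exact .inl ⟨hne, .inl ⟨h, x, h₁, h₂⟩⟩
      · exact .inr ⟨hne.symm, .inl ⟨h, x, h₂, h₁⟩⟩
    · rcases precedes_total hi h₂ (by simp) with h | h
      · exact .inl ⟨hne, .inr (.inl ⟨x, r, h, h₁⟩)⟩
      · exact .inr ⟨hne.symm, .inr (.inr ⟨x, r, h, h₁⟩)⟩
    · rcases precedes_total hj h₁ (by simp) with h | h
      · exact .inr ⟨hne.symm, .inr (.inl ⟨x, r, h, h₂⟩)⟩
      · exact .inl ⟨hne, .inr (.inr ⟨x, r, h, h₂⟩)⟩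

theorem AccessConflict.append {H : List (Event Obj Val)} {i j : ℕ} (h : AccessConflict H i j)
    (e : Event Obj Val) : AccessConflict (H ++ [e]) i j := by
  obtain ⟨hne, hi, hj, x, h⟩ := h
  have hW : ∀ k, Writes H k x → Writes (H ++ [e]) k x :=
    fun k ⟨w, hw⟩ => ⟨w, List.mem_append_left _ hw⟩
  have hR : ∀ k, Reads H k x → Reads (H ++ [e]) k x :=
    fun k ⟨w, hw⟩ => ⟨w, List.mem_append_left _ hw⟩
  refine ⟨hne, List.mem_append_left _ hi, List.mem_append_left _ hj, x, ?_⟩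
  rcases h with h | h | h
  · exact .inl ⟨hW _ h.1, hW _ h.2⟩
  · exact .inr (.inl ⟨hW _ h.1, hR _ h.2⟩)
  · exact .inr (.inr ⟨hR _ h.1, hW _ h.2⟩)

theorem committed_append_iff {H : List (Event Obj Val)} {e : Event Obj Val} {k : ℕ}
    (h : e ≠ .tryC k true) : Committed (H ++ [e]) k ↔ Committed H k := by
  simp [Committed, h.symm]

theorem writes_append_iff {H : List (Event Obj Val)} {e : Event Obj Val} {k : ℕ} {x : Obj}
    (h : e.tx ≠ k) : Writes (H ++ [e]) k x ↔ Writes H k x := by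
  have : ∀ w, Event.write k x w ≠ e := by rintro w rfl; exact h rfl
  simp [Writes, this]

theorem reads_append_iff {H : List (Event Obj Val)} {e : Event Obj Val} {k : ℕ} {x : Obj}
    (h : e.tx ≠ k) : Reads (H ++ [e]) k x ↔ Reads H k x := by
  have : ∀ w, Event.read k x (some w) ≠ e := by rintro w rfl; exact h rfl
  simp [Reads, this]

theorem writes_append_tryC {H : List (Event Obj Val)} {i k : ℕ} {b : Bool} {x : Obj} :
    Writes (H ++ [.tryC i b]) k x ↔ Writes H k x := by simp [Writes]

theorem reads_append_tryC {H : List (Event Obj Val)} {i k : ℕ} {b : Bool} {x : Obj} :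
    Reads (H ++ [.tryC i b]) k x ↔ Reads H k x := by simp [Reads]

theorem writes_append_read {H : List (Event Obj Val)} {i k : ℕ} {r : Option (ℕ × Val)}
    {x y : Obj} : Writes (H ++ [.read i y r]) k x ↔ Writes H k x := by simp [Writes]

theorem writes_append_write {H : List (Event Obj Val)} {i : ℕ} {w : Val} {x y : Obj} :
    Writes (H ++ [.write i y w]) i x ↔ x = y ∨ Writes H i x := by
  simp only [Writes, List.mem_append, List.mem_singleton, Event.write.injEq, true_and]
  constructor
  · rintro ⟨a, h | h⟩
    exacts [.inr ⟨a, h⟩, .inl h.1]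
  · rintro (rfl | ⟨a, h⟩)
    exacts [⟨w, .inr ⟨rfl, rfl⟩⟩, ⟨a, .inl h⟩]

theorem reads_append_write {H : List (Event Obj Val)} {i k : ℕ} {w : Val} {x y : Obj} :
    Reads (H ++ [.write i y w]) k x ↔ Reads H k x := by simp [Reads]

theorem reads_append_read_some {H : List (Event Obj Val)} {i : ℕ} {r : ℕ × Val} {x y : Obj} :
    Reads (H ++ [.read i y (some r)]) i x ↔ x = y ∨ Reads H i x := by
  simp only [Reads, List.mem_append, List.mem_singleton, Event.read.injEq, true_and,
    Option.some.injEq]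
  constructor
  · rintro ⟨a, h | h⟩
    exacts [.inr ⟨a, h⟩, .inl h.1]
  · rintro (rfl | ⟨a, h⟩)
    exacts [⟨r, .inr ⟨rfl, rfl⟩⟩, ⟨a, .inl h⟩]

/-- An event of an uncommitted transaction other than its commit creates no conflict. -/
theorem accessConflict_append_iff {H : List (Event Obj Val)} {e : Event Obj Val}
    (he : ∀ k, e ≠ .tryC k true) (hc : ¬ Committed H e.tx) {i j : ℕ} :
    AccessConflict (H ++ [e]) i j ↔ AccessConflict H i j := by
  refine ⟨?_, fun h => h.append e⟩
  rintro ⟨hne, hi, hj, x, h⟩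
  rw [committed_append_iff (he _)] at hi hj
  have h₁ : e.tx ≠ i := fun h => hc (h ▸ hi)
  have h₂ : e.tx ≠ j := fun h => hc (h ▸ hj)
  rw [writes_append_iff h₁, writes_append_iff h₂, reads_append_iff h₁, reads_append_iff h₂] at h
  exact ⟨hne, hi, hj, x, h⟩

theorem committed_append_tryC {H : List (Event Obj Val)} {i k : ℕ} :
    Committed (H ++ [.tryC i true]) k ↔ k = i ∨ Committed H k := by
  simp [Committed, or_comm]

theorem lookup_isSome_iff [DecidableEq Obj] {wlog : List (Obj × Val)} {x : Obj} :
    (wlog.lookup x).isSome ↔ x ∈ writeSet wlog := by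
  induction wlog with
  | nil => simp [writeSet]
  | cons a l ih =>
    obtain ⟨y, w⟩ := a
    by_cases h : x = y
    · subst h; simp [writeSet]
    · have h' : (x == y) = false := by simpa using h
      simp only [List.lookup_cons, h', ih]
      simp [writeSet, h]

theorem writeSet_cons [DecidableEq Obj] {wlog : List (Obj × Val)} {x y : Obj} {w : Val} :
    x ∈ writeSet ((y, w) :: wlog) ↔ x = y ∨ x ∈ writeSet wlog := by
  simp [writeSet]

end HistoryLemmas

/-! ### Timestamp order of dependencies under BTO and MVTO. -/

section Protocols

variable {Obj : Type u} {Val : Type v}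

/-- An invariant that relates the state of a transactional memory and the history. -/
structure STM.IsInvariant [DecidableEq Obj] (M : STM Obj Val)
    (I : M.State → List (Event Obj Val) → Prop) : Prop where
  initial : I M.initial []
  beginTx : ∀ σ H i au, I σ H → I σ (H ++ [.beginTx i au])
  write : ∀ σ H i x w, I σ H → ¬ Committed H i → I σ (H ++ [.write i x w])
  -- The bound makes version `0` older than the reader, so under MVTO there is always a version to
  -- read.
  read : ∀ σ H i x, I σ H → 1 ≤ i →
    I (M.read σ i x).1 (H ++ [.read i x (M.read σ i x).2])
  tryC : ∀ σ H i wlog, I σ H → ¬ Committed H i →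
    (∀ x, x ∈ writeSet wlog ↔ Writes H i x) →
    I (M.tryC σ i wlog).1 (H ++ [.tryC i (M.tryC σ i wlog).2])

/-- The invariant of basic timestamp ordering: the counters bound the timestamps of the accesses,
and conflicts are ordered by the timestamps. -/
structure BTOInvariant (c : Obj → BTOCell Val) (H : List (Event Obj Val)) : Prop where
  le_maxW : ∀ k x, Committed H k → Writes H k x → k ≤ (c x).maxW
  le_maxR : ∀ k x, Reads H k x → k ≤ (c x).maxR
  write_write : ∀ k m x, Precedes H (.tryC k true) (.tryC m true) → Writes H k x →
    Writes H m x → k ≤ m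
  write_read : ∀ k m x r, Precedes H (.tryC k true) (.read m x (some r)) → Writes H k x → k ≤ m
  read_write : ∀ k m x r, Precedes H (.read k x (some r)) (.tryC m true) → Writes H m x → k ≤ m

/-- Events that neither commit nor read successfully preserve the invariant. -/
theorem BTOInvariant.append {c : Obj → BTOCell Val} {H : List (Event Obj Val)}
    (h : BTOInvariant c H) {e : Event Obj Val} (h₁ : ∀ k, e ≠ .tryC k true)
    (h₂ : ∀ k x r, e ≠ .read k x (some r))
    (h₃ : ∀ k x, Committed H k → Writes (H ++ [e]) k x → Writes H k x) :
    BTOInvariant c (H ++ [e]) := by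
  refine ⟨?_, ?_, ?_, ?_, ?_⟩
  · intro k x hk hw
    rw [committed_append_iff (h₁ k)] at hk
    exact h.le_maxW k x hk (h₃ k x hk hw)
  · rintro k x ⟨r, hr⟩
    rw [List.mem_append, List.mem_singleton] at hr
    exact h.le_maxR k x ⟨r, hr.resolve_right (h₂ k x r).symm⟩
  · intro k m x hp hk hm
    have hp := (precedes_append_singleton hp).resolve_right fun h => h₁ _ h.2.symm
    exact h.write_write k m x hp (h₃ _ _ hp.mem_left hk) (h₃ _ _ hp.mem_right hm)
  · intro k m x r hp hk
    have hp := (precedes_append_singleton hp).resolve_right fun h => h₂ _ _ _ h.2.symm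
    exact h.write_read k m x r hp (h₃ _ _ hp.mem_left hk)
  · intro k m x r hp hm
    have hp := (precedes_append_singleton hp).resolve_right fun h => h₁ _ h.2.symm
    exact h.read_write k m x r hp (h₃ _ _ hp.mem_right hm)

theorem BTOInvariant.append_tryC_false {c : Obj → BTOCell Val} {H : List (Event Obj Val)}
    (h : BTOInvariant c H) (i : ℕ) : BTOInvariant c (H ++ [.tryC i false]) :=
  h.append (by simp) (by simp) fun _ _ _ hw => writes_append_tryC.1 hw

theorem BTOInvariant.append_read_none {c : Obj → BTOCell Val} {H : List (Event Obj Val)}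
    (h : BTOInvariant c H) (i : ℕ) (x : Obj) : BTOInvariant c (H ++ [.read i x none]) :=
  h.append (by simp) (by simp) fun _ _ _ hw => writes_append_read.1 hw

/-- The only new ordered pairs end in the new read. Their first member is the commit of a writer of
`x`, which `le_maxW` bounds by `maxW`, and the read was accepted because `maxW ≤ i`. -/
theorem BTOInvariant.append_read_some {c c' : Obj → BTOCell Val} {H : List (Event Obj Val)}
    (h : BTOInvariant c H) {i : ℕ} {x : Obj} {r : ℕ × Val} (hi : (c x).maxW ≤ i)
    (hW : ∀ y, (c' y).maxW = (c y).maxW) (hR : ∀ y, (c y).maxR ≤ (c' y).maxR)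
    (hx : i ≤ (c' x).maxR) : BTOInvariant c' (H ++ [.read i x (some r)]) := by
  have hc : ∀ k, Committed (H ++ [.read i x (some r)]) k → Committed H k := fun k hk =>
    (committed_append_iff (by simp)).1 hk
  refine ⟨?_, ?_, ?_, ?_, ?_⟩
  · intro k y hk hw
    rw [hW]
    exact h.le_maxW k y (hc k hk) (writes_append_read.1 hw)
  · rintro k y ⟨r', hr⟩
    simp only [List.mem_append, List.mem_singleton, Event.read.injEq] at hr
    rcases hr with hr | ⟨rfl, rfl, -⟩
    · exact (h.le_maxR k y ⟨r', hr⟩).trans (hR y)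
    · exact hx
  · intro k m y hp hk hm
    have hp := (precedes_append_singleton hp).resolve_right (by simp)
    exact h.write_write k m y hp (writes_append_read.1 hk) (writes_append_read.1 hm)
  · intro k m y r' hp hk
    rw [writes_append_read] at hk
    rcases precedes_append_singleton hp with hp' | ⟨hp', he⟩
    · exact h.write_read k m y r' hp' hk
    · simp only [Event.read.injEq] at he
      obtain ⟨rfl, rfl, -⟩ := he
      exact (h.le_maxW k y hp' hk).trans hi
  · intro k m y r' hp hm
    have hp := (precedes_append_singleton hp).resolve_right (by simp)
    exact h.read_write k m y r' hp (writes_append_read.1 hm)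

/-- The test at the commit bounds both counters of each written object by `i`, hence also all
earlier readers and committed writers. For the same reason resetting `maxW` to `i` keeps it an upper
bound. -/
theorem BTOInvariant.append_tryC_true {c c' : Obj → BTOCell Val} {H : List (Event Obj Val)}
    (h : BTOInvariant c H) {i : ℕ}
    (hi : ∀ x, Writes H i x → (c x).maxR ≤ i ∧ (c x).maxW ≤ i)
    (hW : ∀ x, Writes H i x → (c' x).maxW = i)
    (hW' : ∀ x, ¬ Writes H i x → (c' x).maxW = (c x).maxW)
    (hR : ∀ x, (c' x).maxR = (c x).maxR) : BTOInvariant c' (H ++ [.tryC i true]) := by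
  refine ⟨?_, ?_, ?_, ?_, ?_⟩
  · intro k x hk hw
    rw [writes_append_tryC] at hw
    rw [committed_append_tryC] at hk
    by_cases hx : Writes H i x
    · rw [hW x hx]
      rcases hk with rfl | hk
      · exact le_rfl
      · exact (h.le_maxW k x hk hw).trans (hi x hx).2
    · rw [hW' x hx]
      rcases hk with rfl | hk
      · exact absurd hw hx
      · exact h.le_maxW k x hk hw
  · intro k x hk
    rw [hR]
    exact h.le_maxR k x (reads_append_tryC.1 hk)
  · intro k m x hp hk hm
    rw [writes_append_tryC] at hk hm
    rcases precedes_append_singleton hp with hp' | ⟨hp', he⟩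
    · exact h.write_write k m x hp' hk hm
    · simp only [Event.tryC.injEq, and_true] at he
      subst he
      exact (h.le_maxW k x hp' hk).trans (hi x hm).2
  · intro k m x r hp hk
    have hp := (precedes_append_singleton hp).resolve_right (by simp)
    exact h.write_read k m x r hp (writes_append_tryC.1 hk)
  · intro k m x r hp hm
    rw [writes_append_tryC] at hm
    rcases precedes_append_singleton hp with hp' | ⟨hp', he⟩
    · exact h.read_write k m x r hp' hm
    · simp only [Event.tryC.injEq, and_true] at he
      subst he
      exact (h.le_maxR k x ⟨r, hp'⟩).trans (hi x hm).1

theorem bto_isInvariant [DecidableEq Obj] (x₀ : Obj → Val) :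
    (bto x₀).IsInvariant fun σ H => BTOInvariant σ.down H := by
  refine ⟨?_, ?_, ?_, ?_, ?_⟩
  · refine ⟨?_, ?_, ?_, ?_, ?_⟩ <;> simp [Committed, Reads, Precedes]
  · intro σ H i au h
    exact h.append (by simp) (by simp) fun k x _ hw => by simpa [Writes] using hw
  · intro σ H i x w h hi
    refine h.append (by simp) (by simp) fun k y hk hw => (writes_append_iff ?_).1 hw
    rintro rfl
    exact hi hk
  · intro σ H i x h _
    by_cases hlt : i < (σ.down x).maxW
    · have : (bto x₀).read σ i x = (σ, none) := if_pos hlt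
      rw [this]
      exact h.append_read_none i x
    · have : (bto x₀).read σ i x = _ := if_neg hlt
      rw [this]
      refine h.append_read_some (not_lt.1 hlt) ?_ ?_ ?_
      · intro y
        by_cases hy : y = x
        · subst hy; simp
        · simp [hy]
      · intro y
        by_cases hy : y = x
        · subst hy; simp
        · simp [hy]
      · simp
  · intro σ H i wlog h _ hw
    by_cases hex : ∃ x ∈ writeSet wlog, i < (σ.down x).maxR ∨ i < (σ.down x).maxW
    · have : (bto x₀).tryC σ i wlog = (σ, false) := if_pos hex
      rw [this]
      exact h.append_tryC_false i
    · have : (bto x₀).tryC σ i wlog = _ := if_neg hex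
      rw [this]
      push Not at hex
      refine h.append_tryC_true (fun x hx => hex x ((hw x).2 hx)) ?_ ?_ ?_
      · intro x hx
        obtain ⟨v, hv⟩ := Option.isSome_iff_exists.1 (lookup_isSome_iff.2 ((hw x).2 hx))
        simp [hv]
      · intro x hx
        have : wlog.lookup x = none := by
          rw [← Option.not_isSome_iff_eq_none, lookup_isSome_iff, hw]; exact hx
        simp [this]
      · intro x
        dsimp only
        cases wlog.lookup x <;> rfl

/-- The invariant of multi-version timestamp ordering. -/
structure MVTOInvariant (c : Obj → MVTOCell Val) (H : List (Event Obj Val)) : Prop where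
  zero_mem : ∀ x, 0 ∈ (c x).versions
  mem_versions : ∀ k x, Committed H k → Writes H k x → k ∈ (c x).versions
  of_mem_versions : ∀ k x, k ∈ (c x).versions → k = 0 ∨ (Committed H k ∧ Writes H k x)
  readers : ∀ k x j v, Event.read k x (some (j, v)) ∈ H → k ∈ (c x).readers j
  version_mem : ∀ k x j v, Event.read k x (some (j, v)) ∈ H → j ∈ (c x).versions
  version_lt : ∀ k x j v, Event.read k x (some (j, v)) ∈ H → j < k
  version_latest : ∀ k x j v, Event.read k x (some (j, v)) ∈ H →
    ∀ l ∈ (c x).versions, l < k → l ≤ j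

theorem MVTOCell.le_latest {c : MVTOCell Val} {i j : ℕ} (hj : j ∈ c.versions) (hi : j < i) :
    j ≤ c.latest i :=
  Finset.le_sup (f := id) (Finset.mem_filter.2 ⟨hj, hi⟩)

/-- A supremum over the empty set would be the default `0`; version `0` makes the filtered set
nonempty, so the supremum is attained in it. -/
theorem MVTOCell.latest_mem {c : MVTOCell Val} (h0 : 0 ∈ c.versions) {i : ℕ} (hi : 1 ≤ i) :
    c.latest i ∈ c.versions ∧ c.latest i < i := by
  have hne : (c.versions.filter (· < i)).Nonempty := ⟨0, Finset.mem_filter.2 ⟨h0, hi⟩⟩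
  obtain ⟨j, hj, he⟩ := Finset.exists_mem_eq_sup _ hne id
  rw [MVTOCell.latest, he]
  exact Finset.mem_filter.1 hj

/-- Events that neither commit nor read successfully preserve the invariant. -/
theorem MVTOInvariant.append {c : Obj → MVTOCell Val} {H : List (Event Obj Val)}
    (h : MVTOInvariant c H) {e : Event Obj Val} (h₁ : ∀ k, e ≠ .tryC k true)
    (h₂ : ∀ k x r, e ≠ .read k x (some r))
    (h₃ : ∀ k x, Committed H k → Writes (H ++ [e]) k x → Writes H k x) :
    MVTOInvariant c (H ++ [e]) := by
  have hr : ∀ {k x r}, Event.read k x (some r) ∈ H ++ [e] → Event.read k x (some r) ∈ H := by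
    intro k x r hr
    rw [List.mem_append, List.mem_singleton] at hr
    exact hr.resolve_right (h₂ _ _ _).symm
  refine ⟨h.zero_mem, ?_, ?_, ?_, ?_, ?_, ?_⟩
  · intro k x hk hw
    rw [committed_append_iff (h₁ k)] at hk
    exact h.mem_versions k x hk (h₃ k x hk hw)
  · intro k x hk
    rcases h.of_mem_versions k x hk with h | ⟨h, w, hw⟩
    · exact .inl h
    · exact .inr ⟨List.mem_append_left _ h, w, List.mem_append_left _ hw⟩
  · exact fun k x j v hk => h.readers k x j v (hr hk)
  · exact fun k x j v hk => h.version_mem k x j v (hr hk)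
  · exact fun k x j v hk => h.version_lt k x j v (hr hk)
  · exact fun k x j v hk => h.version_latest k x j v (hr hk)

/-- The version returned is by choice the largest one below `i`, which is what the three fields on
versions ask of the new read. -/
theorem MVTOInvariant.append_read_some {c c' : Obj → MVTOCell Val} {H : List (Event Obj Val)}
    (h : MVTOInvariant c H) {i : ℕ} {x : Obj} {v : Val} (hi : 1 ≤ i)
    (hV : ∀ y, (c' y).versions = (c y).versions)
    (hR : ∀ y j, (c y).readers j ⊆ (c' y).readers j)
    (hx : i ∈ (c' x).readers ((c x).latest i)) :
    MVTOInvariant c' (H ++ [.read i x (some ((c x).latest i, v))]) := by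
  have hr : ∀ {k y j w},
      Event.read k y (some (j, w)) ∈ H ++ [.read i x (some ((c x).latest i, v))] →
      Event.read k y (some (j, w)) ∈ H ∨ (k = i ∧ y = x ∧ j = (c x).latest i) := by
    intro k y j w hr
    simp only [List.mem_append, List.mem_singleton, Event.read.injEq, Option.some.injEq,
      Prod.mk.injEq] at hr
    tauto
  have hlat := MVTOCell.latest_mem (h.zero_mem x) hi
  refine ⟨fun y => hV y ▸ h.zero_mem y, ?_, ?_, ?_, ?_, ?_, ?_⟩
  · intro k y hk hw
    rw [hV]
    exact h.mem_versions k y ((committed_append_iff (by simp)).1 hk) (writes_append_read.1 hw)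
  · intro k y hk
    rw [hV] at hk
    rw [committed_append_iff (by simp), writes_append_read]
    exact h.of_mem_versions k y hk
  · intro k y j w hk
    rcases hr hk with hk | ⟨rfl, rfl, rfl⟩
    · exact hR y j (h.readers k y j w hk)
    · exact hx
  · intro k y j w hk
    rw [hV]
    rcases hr hk with hk | ⟨rfl, rfl, rfl⟩
    · exact h.version_mem k y j w hk
    · exact hlat.1
  · intro k y j w hk
    rcases hr hk with hk | ⟨rfl, rfl, rfl⟩
    · exact h.version_lt k y j w hk
    · exact hlat.2
  · intro k y j w hk l hl hlk
    rw [hV] at hl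
    rcases hr hk with hk | ⟨rfl, rfl, rfl⟩
    · exact h.version_latest k y j w hk l hl hlk
    · exact MVTOCell.le_latest hl hlk

/-- The field at risk is `version_latest`: the new version `i` must not fall between a reader and
the version it read. The commit test `hi` excludes exactly this. -/
theorem MVTOInvariant.append_tryC_true {c c' : Obj → MVTOCell Val} {H : List (Event Obj Val)}
    (h : MVTOInvariant c H) {i : ℕ}
    (hi : ∀ x, Writes H i x → ∀ k ∈ (c x).readers ((c x).latest i), k ≤ i)
    (hV : ∀ x, Writes H i x → (c' x).versions = insert i (c x).versions)
    (hV' : ∀ x, ¬ Writes H i x → (c' x).versions = (c x).versions)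
    (hR : ∀ x, (c' x).readers = (c x).readers) : MVTOInvariant c' (H ++ [.tryC i true]) := by
  have hr : ∀ {k y r}, Event.read k y (some r) ∈ H ++ [.tryC i true] →
      Event.read k y (some r) ∈ H := by
    intro k y r hr
    simpa using hr
  have hsub : ∀ x, (c x).versions ⊆ (c' x).versions := by
    intro x
    by_cases hx : Writes H i x
    · rw [hV x hx]; exact Finset.subset_insert _ _
    · rw [hV' x hx]
  have hmem : ∀ x k, k ∈ (c' x).versions → k ∈ (c x).versions ∨ (k = i ∧ Writes H i x) := by
    intro x k hk
    by_cases hx : Writes H i x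
    · rw [hV x hx, Finset.mem_insert] at hk; tauto
    · rw [hV' x hx] at hk; exact .inl hk
  refine ⟨fun x => hsub x (h.zero_mem x), ?_, ?_, ?_, ?_, ?_, ?_⟩
  · intro k x hk hw
    rw [writes_append_tryC] at hw
    rw [committed_append_tryC] at hk
    rcases hk with rfl | hk
    · rw [hV x hw]; exact Finset.mem_insert_self _ _
    · exact hsub x (h.mem_versions k x hk hw)
  · intro k x hk
    rw [writes_append_tryC, committed_append_tryC]
    rcases hmem x k hk with hk | ⟨rfl, hk⟩
    · have := h.of_mem_versions k x hk; tauto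
    · exact .inr ⟨.inl rfl, hk⟩
  · intro k x j v hk
    rw [hR]; exact h.readers k x j v (hr hk)
  · exact fun k x j v hk => hsub x (h.version_mem k x j v (hr hk))
  · exact fun k x j v hk => h.version_lt k x j v (hr hk)
  · intro k x j v hk l hl hlk
    replace hk := hr hk
    rcases hmem x l hl with hl | ⟨rfl, hw⟩
    · exact h.version_latest k x j v hk l hl hlk
    -- Suppose `j < l < k` for the new version `l`. Maximality of `j` among the old versions below
    -- `k` forces `latest l = j`, so `T_k` is a younger reader of the version that the commit of
    -- `T_l` inspects, and the test would have failed.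
    · by_contra! hjl
      have hj := h.version_mem k x j v hk
      have hle := MVTOCell.le_latest hj hjl
      have hlm := MVTOCell.latest_mem (h.zero_mem x) (Nat.one_le_of_lt hjl)
      have hge := h.version_latest k x j v hk _ hlm.1 (hlm.2.trans hlk)
      have heq : (c x).latest l = j := le_antisymm hge hle
      exact absurd (hi x hw k (heq ▸ h.readers k x j v hk)) (not_le.2 hlk)

theorem mvto_isInvariant [DecidableEq Obj] (x₀ : Obj → Val) :
    (mvto x₀).IsInvariant fun σ H => MVTOInvariant σ.down H := by
  refine ⟨?_, ?_, ?_, ?_, ?_⟩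
  · refine ⟨?_, ?_, ?_, ?_, ?_, ?_, ?_⟩ <;> simp [Committed, mvto]
  · intro σ H i au h
    exact h.append (by simp) (by simp) fun k x _ hw => by simpa [Writes] using hw
  · intro σ H i x w h hi
    refine h.append (by simp) (by simp) fun k y hk hw => (writes_append_iff ?_).1 hw
    rintro rfl
    exact hi hk
  · intro σ H i x h hi
    refine h.append_read_some hi ?_ ?_ ?_
    · intro y
      by_cases hy : y = x
      · subst hy; simp [mvto]
      · simp [mvto, hy]
    · intro y j
      by_cases hy : y = x
      · subst hy
        by_cases hj : j = (σ.down y).latest i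
        · subst hj; simp [mvto]
        · simp [mvto, hj]
      · simp [mvto, hy]
    · simp [mvto]
  · intro σ H i wlog h _ hw
    by_cases hex : ∃ x ∈ writeSet wlog, ∃ k ∈ (σ.down x).readers ((σ.down x).latest i), i < k
    · have : (mvto x₀).tryC σ i wlog = (σ, false) := if_pos hex
      rw [this]
      exact h.append (by simp) (by simp) fun _ _ _ hw => writes_append_tryC.1 hw
    · have : (mvto x₀).tryC σ i wlog = _ := if_neg hex
      rw [this]
      push Not at hex
      refine h.append_tryC_true (fun x hx => hex x ((hw x).2 hx)) ?_ ?_ ?_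
      · intro x hx
        obtain ⟨v, hv⟩ := Option.isSome_iff_exists.1 (lookup_isSome_iff.2 ((hw x).2 hx))
        simp [hv]
      · intro x hx
        have : wlog.lookup x = none := by
          rw [← Option.not_isSome_iff_eq_none, lookup_isSome_iff, hw]; exact hx
        simp [this]
      · intro x
        dsimp only
        cases wlog.lookup x <;> rfl

/-- Both protocols order dependent transactions by their timestamps, and dependent transactions
are in conflict. -/
theorem Protocol.exists_isInvariant [DecidableEq Obj] (P : Protocol) (x₀ : Obj → Val) :
    ∃ I : (P.stm x₀).State → List (Event Obj Val) → Prop, (P.stm x₀).IsInvariant I ∧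
      ∀ σ H, I σ H → (∀ i, Committed H i → 1 ≤ i) →
        ∀ k m, Dependency P H k m → k < m ∧ AccessConflict H k m := by
  cases P with
  | BTO =>
    refine ⟨_, bto_isInvariant x₀, ?_⟩
    rintro σ H h - k m ⟨hk, hm, hd⟩
    -- The invariant gives only `k ≤ m`; strictness comes from the distinctness built into
    -- `ConflictOrder`.
    refine ⟨lt_of_le_of_ne ?_ hd.1, conflicting_iff_accessConflict.1 ⟨hk, hm, .inl hd⟩⟩
    rcases hd.2 with ⟨hp, x, h₁, h₂⟩ | ⟨x, r, hp, hw⟩ | ⟨x, r, hp, hw⟩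
    · exact h.write_write k m x hp h₁ h₂
    · exact h.write_read k m x r hp hw
    · exact h.read_write k m x r hp hw
  | MVTO =>
    refine ⟨_, mvto_isInvariant x₀, ?_⟩
    rintro σ H h hpos k m ⟨hk, hm, hne, hd⟩
    rcases hd with ⟨x, w, hr⟩ | ⟨x, h₁, h₂, hlt⟩ | ⟨x, j, w, hr, hw, hj⟩
    -- Committed timestamps are positive, so version `k` is not the initial one and was written by
    -- `T_k`.
    · have hwr := (h.of_mem_versions k x (h.version_mem m x k w hr)).resolve_left
        (Nat.one_le_iff_ne_zero.1 (hpos k hk))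
      exact ⟨h.version_lt m x k w hr, hne, hk, hm, x, .inr (.inl ⟨hwr.2, _, hr⟩)⟩
    · exact ⟨hlt, hne, hk, hm, x, .inl ⟨h₁, h₂⟩⟩
    · refine ⟨?_, hne, hk, hm, x, .inr (.inr ⟨⟨_, hr⟩, hw⟩)⟩
      -- If `m < k`, version `m` was a candidate for the read of `T_k`, so `m ≤ j`, against `j < m`.
      by_contra! hmk
      have := h.version_latest k x j w hr m (h.mem_versions m x hm hw)
        (lt_of_le_of_ne hmk hne.symm)
      omega

end Protocols

/-! ### Lock-free lists: insertion steps only add nodes. -/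

section ListLemmas

variable {α : Type}

/-- All nodes of the list are allocated. -/
def LockFreeList.Allocated (l : LockFreeList α) : Prop := ∀ a, l.Linked a → a < l.size

theorem LockFreeList.Linked.next {l : LockFreeList α} {a : ℕ} (h : l.Linked a) :
    l.Linked (l.node a).next := Relation.ReflTransGen.tail h rfl

theorem LockFreeList.linked_head (l : LockFreeList α) : l.Linked 0 := .refl

theorem LockFreeList.linked_empty {d : α} {a : ℕ} (h : (LockFreeList.empty d).Linked a) :
    a = 0 ∨ a = 1 := by
  induction h with
  | refl => exact .inl rfl
  | tail _ h ih =>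
    -- Both sentinels have next pointer `1`; the tail points to itself.
    rcases ih with rfl | rfl <;> simp [LockFreeList.empty] at h <;> exact .inr h.symm

theorem LockFreeList.allocated_empty (d : α) : (LockFreeList.empty d).Allocated := by
  intro a h
  rcases linked_empty h with rfl | rfl <;> simp [LockFreeList.empty]

theorem LockFreeList.key_empty (d : α) (a i : ℕ) :
    ((LockFreeList.empty d).node a).key ≠ tsKey i := by
  by_cases h : a = 0
  · simp [LockFreeList.empty, h, tsKey]
  · simp only [LockFreeList.empty, h, if_false, tsKey]
    intro h
    have h' : (⊤ : WithTop ℕ) = (i : WithTop ℕ) := WithBot.coe_injective h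
    exact WithTop.top_ne_coe h'

/-- The window of a search consists of linked nodes. -/
def LockFreeList.WindowOK (l : LockFreeList α) (w : Window) : Prop :=
  l.Linked w.pred ∧ ∀ c, w.curr = some c → l.Linked c

theorem LockFreeList.windowOK_start (l : LockFreeList α) : l.WindowOK Window.start :=
  ⟨l.linked_head, by simp [Window.start]⟩

/-- `l'` arises from `l` by insertions. -/
def LockFreeList.Extends (l l' : LockFreeList α) : Prop :=
  ∀ a, l.Linked a → l'.Linked a ∧ (l'.node a).key = (l.node a).key ∧
    (l'.node a).data = (l.node a).data

theorem LockFreeList.Extends.refl (l : LockFreeList α) : l.Extends l := fun _ h => ⟨h, rfl, rfl⟩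

theorem LockFreeList.WindowOK.mono {l l' : LockFreeList α} (hl : ∀ a, l.Linked a → l'.Linked a)
    {w : Window} (hw : l.WindowOK w) : l'.WindowOK w :=
  ⟨hl _ hw.1, fun c hc => hl _ (hw.2 c hc)⟩

/-- The meaning of the result of a step of the insertion of `k`. -/
def LockFreeList.ResultOK (l : LockFreeList α) (k : Key) : InsertResult → Prop
  | .again w => l.WindowOK w
  | .present a => l.Linked a ∧ (l.node a).key = k
  | .added a => l.Linked a ∧ (l.node a).key = k

/-- The effect of a step of an insertion. -/
structure LockFreeList.InsertSpec (l : LockFreeList α) (k : Key) (d : α)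
    (r : LockFreeList α × InsertResult) : Prop where
  allocated : r.1.Allocated
  ext : l.Extends r.1
  new : ∀ a, r.1.Linked a → l.Linked a ∨ ((r.1.node a).key = k ∧ (r.1.node a).data = d)
  result : r.1.ResultOK k r.2

theorem LockFreeList.insertSpec_of_unchanged {l : LockFreeList α} (hl : l.Allocated) {k : Key}
    {d : α} {r : InsertResult} (hr : l.ResultOK k r) : l.InsertSpec k d (l, r) :=
  ⟨hl, .refl l, fun _ h => .inl h, hr⟩

/-- By `Allocated` the address `l.size` is not linked, so writing there disturbs no linked node. The
link `p → c` becomes `p → l.size → c`: old paths are lengthened, and new paths reach only one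
further node. Nothing is assumed of `c`, since a successful comparison identifies it with the
successor of `p`. -/
theorem LockFreeList.cas_spec {l : LockFreeList α} (hl : l.Allocated) {p c : ℕ}
    (hp : l.Linked p) (k : Key) (d : α) : l.InsertSpec k d (l.cas p c k d) := by
  unfold LockFreeList.cas
  split_ifs with hc
  swap
  · exact insertSpec_of_unchanged hl ⟨hp, by simp⟩
  set l' : LockFreeList α := ⟨Function.update
    (Function.update l.node p { l.node p with next := l.size }) l.size ⟨k, c, d⟩, l.size + 1⟩
    with hl'
  have hnew : l'.node l.size = ⟨k, c, d⟩ := by simp [hl']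
  have hold : ∀ a, l.Linked a → a ≠ p → l'.node a = l.node a := by
    intro a ha hap
    simp [hl', Function.update_of_ne hap, Function.update_of_ne (hl a ha).ne]
  have hpred : l'.node p = { l.node p with next := l.size } := by
    simp [hl', Function.update_of_ne (hl p hp).ne]
  have hkd : ∀ a, l.Linked a → (l'.node a).key = (l.node a).key ∧
      (l'.node a).data = (l.node a).data := by
    intro a ha
    by_cases hap : a = p
    · subst hap; simp [hpred]
    · simp [hold a ha hap]
  have hfwd : ∀ a, l.Linked a → l'.Linked a := by
    intro a ha
    induction ha with
    | refl => exact .refl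
    | @tail b a hb h ih =>
      by_cases hbp : b = p
      -- A path that leaves `p` is rerouted through the new node.
      · subst hbp
        have h₁ : l'.Linked l.size := ih.tail (by simp [hpred])
        exact h₁.tail (by simp [hnew, ← h, hc])
      · exact ih.tail (by simp [hold b hb hbp, h])
  have hbwd : ∀ a, l'.Linked a → l.Linked a ∨ a = l.size := by
    intro a ha
    induction ha with
    | refl => exact .inl .refl
    | @tail b a hb h ih =>
      rcases ih with ih | rfl
      · by_cases hbp : b = p
        · subst hbp
          right; simp [← h, hpred]
        · left
          rw [hold b ih hbp] at h
          exact ih.tail h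
      · left
        rw [hnew] at h
        -- The successor of the new node is `c`, which was already the successor of `p`.
        exact hp.tail (hc.trans h)
  have hlink : l'.Linked l.size := (hfwd p hp).tail (by simp [hpred])
  refine ⟨?_, fun a ha => ⟨hfwd a ha, hkd a ha⟩, ?_, ⟨hlink, by simp [hnew]⟩⟩
  · intro a ha
    change a < l.size + 1
    rcases hbwd a ha with h | h
    · exact (hl a h).trans (Nat.lt_succ_self _)
    · omega
  · intro a ha
    rcases hbwd a ha with h | rfl
    · exact .inl h
    · right; simp [hnew]

theorem LockFreeList.insertStep_spec {l : LockFreeList α} (hl : l.Allocated) {w : Window}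
    (hw : l.WindowOK w) (k : Key) (d : α) : l.InsertSpec k d (l.insertStep k d w) := by
  unfold LockFreeList.insertStep
  obtain ⟨p, _ | c⟩ := w
  · exact insertSpec_of_unchanged hl ⟨hw.1, by rintro c ⟨⟩; exact LockFreeList.Linked.next hw.1⟩
  · have hc : l.Linked c := hw.2 c rfl
    dsimp only
    split_ifs with h₁ h₂
    · exact insertSpec_of_unchanged hl ⟨hc, by simp⟩
    · exact insertSpec_of_unchanged hl ⟨hc, h₂⟩
    · exact cas_spec hl hw.1 k d

theorem LockFreeList.linked_setData {l : LockFreeList α} {a b : ℕ} {d : α} :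
    (l.setData a d).Linked b ↔ l.Linked b := by
  have : (fun b c => ((l.setData a d).node b).next = c) = fun b c => (l.node b).next = c := by
    funext b c
    by_cases h : b = a
    · subst h; simp [LockFreeList.setData]
    · simp [LockFreeList.setData, h]
  simp only [LockFreeList.Linked, this]

theorem LockFreeList.key_setData {l : LockFreeList α} {a b : ℕ} {d : α} :
    ((l.setData a d).node b).key = (l.node b).key := by
  by_cases h : b = a
  · subst h; simp [LockFreeList.setData]
  · simp [LockFreeList.setData, h]

theorem LockFreeList.data_setData_self {l : LockFreeList α} {a : ℕ} {d : α} :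
    ((l.setData a d).node a).data = d := by simp [LockFreeList.setData]

theorem LockFreeList.data_setData_of_ne {l : LockFreeList α} {a b : ℕ} {d : α} (h : b ≠ a) :
    ((l.setData a d).node b).data = (l.node b).data := by simp [LockFreeList.setData, h]

end ListLemmas

/-! ### Block graph: monotonicity and safety of its atomic steps. -/

section GraphLemmas

/-- `G'` arises from `G` by adding vertices and edges. -/
structure BlockGraph.Extends (G G' : BlockGraph) : Prop where
  linked : ∀ a, G.Linked a → G'.Linked a
  key : ∀ a, G.Linked a → (G'.node a).key = (G.node a).key
  edges : ∀ a, G.Linked a → (G.node a).data.edges.Extends (G'.node a).data.edges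

variable {G G' : BlockGraph}

theorem BlockGraph.Extends.refl (G : BlockGraph) : G.Extends G :=
  ⟨fun _ h => h, fun _ _ => rfl, fun _ _ => .refl _⟩

theorem BlockGraph.VertexAt.mono (h : G.Extends G') {a i : ℕ} (ha : G.VertexAt a i) :
    G'.VertexAt a i := ⟨h.linked a ha.1, (h.key a ha.1).trans ha.2⟩

theorem BlockGraph.EdgeAt.mono (h : G.Extends G') {a e j : ℕ} (ha : G.Linked a)
    (he : G.EdgeAt a e j) : G'.EdgeAt a e j :=
  ⟨(h.edges a ha e he.1).1, (h.edges a ha e he.1).2.1.trans he.2⟩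

theorem BlockGraph.target_mono (h : G.Extends G') {a e j : ℕ} (ha : G.Linked a)
    (he : G.EdgeAt a e j) : G'.target a e = G.target a e := by
  simp only [BlockGraph.target, (h.edges a ha e he.1).2.2]

theorem BlockGraph.HasEdge.mono (h : G.Extends G') {i j : ℕ} (hG : G.HasEdge i j) :
    G'.HasEdge i j := by
  obtain ⟨a, e, ha, he, ht⟩ := hG
  exact ⟨a, e, ha.mono h, he.mono h ha.1, by rw [target_mono h ha.1 he]; exact ht.mono h⟩

/-- The safety invariant of the block graph: vertices satisfy `V` (of the timestamp and the
identifier of the atomic-unit), and edges satisfy `E`. -/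
structure BlockGraph.Safe (G : BlockGraph) (V : ℕ → ℕ → Prop) (E : ℕ → ℕ → Prop) : Prop where
  allocated : LockFreeList.Allocated G
  edges_allocated : ∀ a, G.Linked a → (G.node a).data.edges.Allocated
  vertex : ∀ a i, G.VertexAt a i → V i (G.node a).data.auId
  edge : ∀ a e i j, G.VertexAt a i → G.EdgeAt a e j → E i j ∧ G.VertexAt (G.target a e) j

variable {V V' : ℕ → ℕ → Prop} {E E' : ℕ → ℕ → Prop}

theorem BlockGraph.Safe.imp (h : G.Safe V E) (hV : ∀ i a, V i a → V' i a)
    (hE : ∀ i j, E i j → E' i j) : G.Safe V' E' :=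
  ⟨h.allocated, h.edges_allocated, fun a i ha => hV _ _ (h.vertex a i ha),
    fun a e i j ha he => ⟨hE _ _ (h.edge a e i j ha he).1, (h.edge a e i j ha he).2⟩⟩

theorem BlockGraph.safe_initial : BlockGraph.initial.Safe V E := by
  refine ⟨LockFreeList.allocated_empty _, fun a _ => ?_, fun a i ha => ?_, fun a _ i _ ha => ?_⟩
  · have : (BlockGraph.initial.node a).data = VertexData.new 0 := by
      simp only [BlockGraph.initial, LockFreeList.empty]; split_ifs <;> rfl
    rw [this]
    exact LockFreeList.allocated_empty _
  · exact absurd ha.2 (LockFreeList.key_empty _ a i)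
  · exact absurd ha.2 (LockFreeList.key_empty _ a i)

theorem tsKey_injective : Function.Injective tsKey := fun _ _ h =>
  WithTop.coe_injective (WithBot.coe_injective h)

/-- Old vertices keep their payload, and a new vertex starts with an empty edge list, so it owes
nothing to `E`. -/
theorem BlockGraph.addVertStep_spec (hG : G.Safe V E) {i au : ℕ} (hV : V i au) {w : Window}
    (hw : LockFreeList.WindowOK G w) :
    G.Extends (G.addVertStep i au w).1 ∧ (G.addVertStep i au w).1.Safe V E ∧
      LockFreeList.ResultOK (G.addVertStep i au w).1 (tsKey i) (G.addVertStep i au w).2 := by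
  have hs := LockFreeList.insertStep_spec hG.allocated hw (tsKey i) (VertexData.new au)
  change LockFreeList.InsertSpec G _ _ (G.addVertStep i au w) at hs
  generalize G.addVertStep i au w = r at hs
  obtain ⟨G', r⟩ := r
  obtain ⟨hal, hext, hnew, hres⟩ := hs
  dsimp only at hal hext hnew hres ⊢
  have hle : G.Extends G' := ⟨fun a ha => (hext a ha).1, fun a ha => (hext a ha).2.1,
    fun a ha => by rw [(hext a ha).2.2]; exact .refl _⟩
  refine ⟨hle, ⟨hal, ?_, ?_, ?_⟩, hres⟩
  · intro a ha
    rcases hnew a ha with h | h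
    · rw [(hext a h).2.2]; exact hG.edges_allocated a h
    · rw [h.2]; exact LockFreeList.allocated_empty _
  · intro a k ha
    rcases hnew a ha.1 with h | h
    · rw [(hext a h).2.2]
      exact hG.vertex a k ⟨h, (hext a h).2.1 ▸ ha.2⟩
    · rw [h.2]
      obtain rfl : i = k := tsKey_injective (h.1.symm.trans ha.2)
      exact hV
  · intro a e k j ha he
    rcases hnew a ha.1 with h | h
    · have he' : G.EdgeAt a e j := by
        unfold BlockGraph.EdgeAt at he ⊢
        rwa [(hext a h).2.2] at he
      have := hG.edge a e k j ⟨h, (hext a h).2.1 ▸ ha.2⟩ he'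
      rw [target_mono hle h he']
      exact ⟨this.1, this.2.mono hle⟩
    · have := he.2
      rw [h.2] at this
      exact absurd this (LockFreeList.key_empty _ e j)

theorem BlockGraph.extends_setData {a : ℕ} {d : VertexData}
    (hd : (G.node a).data.edges.Extends d.edges) : G.Extends (G.setData a d) := by
  refine ⟨fun b hb => LockFreeList.linked_setData.2 hb, fun b _ => LockFreeList.key_setData,
    fun b _ => ?_⟩
  by_cases h : b = a
  · subst h; rwa [LockFreeList.data_setData_self]
  · rw [LockFreeList.data_setData_of_ne h]; exact .refl _

theorem BlockGraph.vertexAt_setData {a b i : ℕ} {d : VertexData} :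
    BlockGraph.VertexAt (G.setData a d) b i ↔ G.VertexAt b i := by
  simp only [BlockGraph.VertexAt, LockFreeList.linked_setData, LockFreeList.key_setData]

/-- Replacing the payload of a vertex node keeps the graph safe, if the new edge nodes are. -/
theorem BlockGraph.Safe.setData (hG : G.Safe V E) {a : ℕ} {d : VertexData}
    (hau : d.auId = (G.node a).data.auId) (hal : d.edges.Allocated)
    (hnew : ∀ i e j, G.VertexAt a i → d.edges.Linked e → (d.edges.node e).key = tsKey j →
      E i j ∧ G.VertexAt (d.edges.node e).data.vref j) :
    BlockGraph.Safe (G.setData a d) V E := by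
  refine ⟨fun b hb => hG.allocated b (LockFreeList.linked_setData.1 hb), ?_, ?_, ?_⟩
  · intro b hb
    by_cases h : b = a
    · subst h; rwa [LockFreeList.data_setData_self]
    · rw [LockFreeList.data_setData_of_ne h]
      exact hG.edges_allocated b (LockFreeList.linked_setData.1 hb)
  · intro b i hb
    rw [vertexAt_setData] at hb
    by_cases h : b = a
    · subst h; rw [LockFreeList.data_setData_self, hau]; exact hG.vertex b i hb
    · rw [LockFreeList.data_setData_of_ne h]; exact hG.vertex b i hb
  · intro b e i j hb he
    rw [vertexAt_setData] at hb
    rw [vertexAt_setData]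
    unfold BlockGraph.target
    unfold BlockGraph.EdgeAt at he
    by_cases h : b = a
    · subst h
      rw [LockFreeList.data_setData_self] at he ⊢
      exact hnew i e j hb he.1 he.2
    · rw [LockFreeList.data_setData_of_ne h] at he ⊢
      exact hG.edge b e i j hb he

/-- A new edge node takes its key from the vertex node `b` and stores the address `b`, so its
timestamp and its reference agree. An edge node found with the same key was safe before. -/
theorem BlockGraph.addEdgeStep_spec (hG : G.Safe V E) {a b i j : ℕ} (ha : G.VertexAt a i)
    (hb : G.VertexAt b j) (hE : E i j) {w : Window}
    (hw : (G.node a).data.edges.WindowOK w) :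
    G.Extends (G.addEdgeStep a b w).1 ∧ (G.addEdgeStep a b w).1.Safe V E ∧
      ((G.addEdgeStep a b w).1.node a).data.edges.ResultOK (tsKey j)
        (G.addEdgeStep a b w).2 := by
  have hs := LockFreeList.insertStep_spec (hG.edges_allocated a ha.1) hw (tsKey j) ⟨b⟩
  have heq : G.addEdgeStep a b w =
      (G.setData a { (G.node a).data with
        edges := ((G.node a).data.edges.insertStep (tsKey j) ⟨b⟩ w).1 },
       ((G.node a).data.edges.insertStep (tsKey j) ⟨b⟩ w).2) := by
    rw [← hb.2]; rfl
  rw [heq]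
  generalize (G.node a).data.edges.insertStep (tsKey j) ⟨b⟩ w = r at hs
  obtain ⟨hal, hext, hnew, hres⟩ := hs
  refine ⟨extends_setData hext, hG.setData rfl hal ?_, ?_⟩
  · intro i' e j' ha' he hk
    dsimp only at he hk ⊢
    rcases hnew e he with h | h
    · rw [(hext e h).2.2]
      rw [(hext e h).2.1] at hk
      exact hG.edge a e i' j' ha' ⟨h, hk⟩
    -- A node has one key, so the hypothesis `hE` on `i` and `j` covers whatever timestamps are read
    -- off the new edge.
    · obtain rfl : i = i' := tsKey_injective (ha.2.symm.trans ha'.2)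
      obtain rfl : j = j' := tsKey_injective (h.1.symm.trans hk)
      rw [h.2]
      exact ⟨hE, hb⟩
  · dsimp only
    rw [LockFreeList.data_setData_self]
    exact hres

theorem BlockGraph.incInCnt_spec (hG : G.Safe V E) {b : ℕ} (hb : G.Linked b) :
    G.Extends (G.incInCnt b) ∧ (G.incInCnt b).Safe V E :=
  ⟨extends_setData (.refl _), hG.setData rfl (hG.edges_allocated b hb)
    fun _ e _ hi he hk => hG.edge b e _ _ hi ⟨he, hk⟩⟩

/-- A safe graph with an edge node for `j` in the edge list of a vertex `i` has that edge. -/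
theorem BlockGraph.Safe.hasEdge (hG : G.Safe V E) {a e i j : ℕ} (ha : G.VertexAt a i)
    (he : G.EdgeAt a e j) : G.HasEdge i j := ⟨a, e, ha, he, (hG.edge a e i j ha he).2⟩

end GraphLemmas

/-! ### Invariant of the history, the conflict table and the running transactions. -/

section MinerInvariant

variable {Obj : Type u} {Val : Type v}

/-- The transaction that the thread executes. -/
def ThreadState.running? : ThreadState Obj Val → Option ℕ
  | .exec _ _ i _ _ _ => some i
  | _ => none

/-- The read set and the write log of a running transaction agree with the history. -/
def ThreadState.ExecOK [DecidableEq Obj] (H : List (Event Obj Val)) (clock : ℕ) :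
    ThreadState Obj Val → Prop
  | .exec _ _ i _ rset wlog => (1 ≤ i ∧ i < clock) ∧ ¬ Committed H i ∧
      (∀ x, x ∈ rset ↔ Reads H i x) ∧ ∀ x, x ∈ writeSet wlog ↔ Writes H i x
  | _ => True

theorem ThreadState.execOK_of_running?_eq_none [DecidableEq Obj] {H : List (Event Obj Val)}
    {clock : ℕ} {p : ThreadState Obj Val} (h : p.running? = none) : p.ExecOK H clock := by
  cases p with
  | exec => simp [running?] at h
  | _ => trivial

theorem ThreadState.ExecOK.append [DecidableEq Obj] {H : List (Event Obj Val)}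
    {clock clock' : ℕ} {p : ThreadState Obj Val} (h : p.ExecOK H clock) (hc : clock ≤ clock')
    {e : Event Obj Val} (he : p.running? ≠ some e.tx) : p.ExecOK (H ++ [e]) clock' := by
  cases p with
  | exec au prog i cont rset wlog =>
    have hne : e.tx ≠ i := fun h => he (by rw [h]; rfl)
    obtain ⟨⟨h₁, h₂⟩, h₃, h₄, h₅⟩ := h
    refine ⟨⟨h₁, h₂.trans_le hc⟩, ?_, ?_, ?_⟩
    · rwa [committed_append_iff]
      rintro rfl
      exact hne rfl
    · intro x; rw [reads_append_iff hne]; exact h₄ x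
    · intro x; rw [writes_append_iff hne]; exact h₅ x
  | _ => trivial

/-- The invariant that relates the history, the conflict lists and the threads. -/
structure HistoryInvariant [DecidableEq Obj] {n : ℕ} (H : List (Event Obj Val))
    (c : ConflictTable Obj) (clock : ℕ) (auOf : ℕ → ℕ) (th : Fin n → ThreadState Obj Val) :
    Prop where
  clock_pos : 1 ≤ clock
  tx_mem : ∀ e ∈ H, 1 ≤ e.tx ∧ e.tx < clock
  auOf : ∀ i, 1 ≤ i → i < clock → Event.beginTx i (auOf i) ∈ H
  exec : ∀ t, (th t).ExecOK H clock
  -- Ensures that an event of one thread leaves the read sets and write logs of all other threads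
  -- valid.
  exec_inj : ∀ t t' i, (th t).running? = some i → (th t').running? = some i → t = t'
  building : ∀ t i, (th t).building? = some i → Committed H i
  readersOf : ∀ i x, i ∈ c.readersOf x ↔ Committed H i ∧ Reads H i x
  writersOf : ∀ i x, i ∈ c.writersOf x ↔ Committed H i ∧ Writes H i x
  of_mem_confList : ∀ i j, j ∈ c.confList i → AccessConflict H i j
  -- Only a disjunction can hold: a list is fixed at the commit of its owner and never learns of
  -- later commits.
  mem_confList : ∀ i j, AccessConflict H i j → j ∈ c.confList i ∨ i ∈ c.confList j

variable {n : ℕ} {H : List (Event Obj Val)} {c : ConflictTable Obj}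
  {clock : ℕ} {auOf : ℕ → ℕ} {th : Fin n → ThreadState Obj Val}

theorem exec_inj_update {t : Fin n} {p : ThreadState Obj Val}
    (h : ∀ t t' i, (th t).running? = some i → (th t').running? = some i → t = t')
    (hp : ∀ i t', t' ≠ t → p.running? = some i → (th t').running? ≠ some i) :
    ∀ t₁ t₂ i, (Function.update th t p t₁).running? = some i →
      (Function.update th t p t₂).running? = some i → t₁ = t₂ := by
  intro t₁ t₂ i h₁ h₂
  by_cases ht₁ : t₁ = t <;> by_cases ht₂ : t₂ = t
  · rw [ht₁, ht₂]
  · subst ht₁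
    rw [Function.update_self] at h₁
    rw [Function.update_of_ne ht₂] at h₂
    exact absurd h₂ (hp i t₂ ht₂ h₁)
  · subst ht₂
    rw [Function.update_self] at h₂
    rw [Function.update_of_ne ht₁] at h₁
    exact absurd h₁ (hp i t₁ ht₁ h₂)
  · rw [Function.update_of_ne ht₁] at h₁
    rw [Function.update_of_ne ht₂] at h₂
    exact h t₁ t₂ i h₁ h₂

theorem forall_update {α : Type*} {p : α} {f : Fin n → α} {t : Fin n} {Q : α → Prop}
    (hp : Q p) (hf : ∀ t', t' ≠ t → Q (f t')) : ∀ t', Q (Function.update f t p t') := by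
  intro t'
  by_cases h : t' = t
  · subst h; rwa [Function.update_self]
  · rw [Function.update_of_ne h]; exact hf t' h

variable [DecidableEq Obj]

theorem HistoryInvariant.committed_pos (h : HistoryInvariant H c clock auOf th) {i : ℕ}
    (hi : Committed H i) : 1 ≤ i := (h.tx_mem _ hi).1

theorem HistoryInvariant.beginTx_mem (h : HistoryInvariant H c clock auOf th) {i : ℕ}
    (hi : Committed H i) : Event.beginTx i (auOf i) ∈ H :=
  h.auOf i (h.tx_mem _ hi).1 (h.tx_mem _ hi).2

/-- A step of a thread that generates no event. -/
theorem HistoryInvariant.goto (h : HistoryInvariant H c clock auOf th) (t : Fin n)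
    {p : ThreadState Obj Val} (hrun : p.running? = none ∨ p.running? = (th t).running?)
    (hexec : p.ExecOK H clock) (hb : ∀ i, p.building? = some i → Committed H i) :
    HistoryInvariant H c clock auOf (Function.update th t p) where
  __ := h
  exec := forall_update hexec fun t' _ => h.exec t'
  exec_inj := by
    refine exec_inj_update h.exec_inj fun i t' ht hi hi' => ?_
    rcases hrun with hr | hr
    · simp [hr] at hi
    · exact ht (h.exec_inj t' t i hi' (hr ▸ hi))
  building := forall_update (Q := fun p : ThreadState Obj Val => ∀ i, p.building? = some i → Committed H i) hb
    fun t' _ => h.building t'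

/-- A step of a thread that goes on with the construction of the graph. -/
theorem HistoryInvariant.goto_building (h : HistoryInvariant H c clock auOf th) (t : Fin n)
    {p : ThreadState Obj Val} (hrun : p.running? = none)
    (hb : p.building? = none ∨ p.building? = (th t).building?) :
    HistoryInvariant H c clock auOf (Function.update th t p) := by
  refine h.goto t (.inl hrun) (ThreadState.execOK_of_running?_eq_none hrun) fun i hi => ?_
  rcases hb with hb | hb
  · simp [hb] at hi
  · exact h.building t i (hb ▸ hi)

/-- An operation of a running transaction other than a successful commit. -/
theorem HistoryInvariant.append (h : HistoryInvariant H c clock auOf th) {t : Fin n}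
    {e : Event Obj Val} (ht : (th t).running? = some e.tx) (he : ∀ k, e ≠ .tryC k true)
    (hnc : ¬ Committed H e.tx) (hpos : 1 ≤ e.tx ∧ e.tx < clock)
    {p : ThreadState Obj Val} (hrun : p.running? = none ∨ p.running? = some e.tx)
    (hexec : p.ExecOK (H ++ [e]) clock) (hb : p.building? = none) :
    HistoryInvariant (H ++ [e]) c clock auOf (Function.update th t p) where
  clock_pos := h.clock_pos
  tx_mem := by
    intro e' he'
    rcases List.mem_append.1 he' with he' | he'
    · exact h.tx_mem e' he'
    · rw [List.mem_singleton.1 he']; exact hpos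
  auOf i h₁ h₂ := List.mem_append_left _ (h.auOf i h₁ h₂)
  exec := forall_update hexec fun t' ht' =>
    (h.exec t').append le_rfl fun hr => ht' (h.exec_inj t' t _ hr ht)
  exec_inj := by
    refine exec_inj_update h.exec_inj fun i t' ht' hi hi' => ?_
    rcases hrun with hr | hr
    · simp [hr] at hi
    · exact ht' (h.exec_inj t' t i hi' ((ht.trans hr.symm).trans hi))
  building := forall_update (Q := fun p : ThreadState Obj Val => ∀ i, p.building? = some i → Committed (H ++ [e]) i)
    (by simp [hb]) fun t' _ i hi => List.mem_append_left _ (h.building t' i hi)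
  readersOf i x := by
    rw [h.readersOf, committed_append_iff (he i)]
    refine and_congr_right fun hi => (reads_append_iff ?_).symm
    rintro rfl; exact hnc hi
  writersOf i x := by
    rw [h.writersOf, committed_append_iff (he i)]
    refine and_congr_right fun hi => (writes_append_iff ?_).symm
    rintro rfl; exact hnc hi
  of_mem_confList i j hj := (h.of_mem_confList i j hj).append e
  mem_confList i j hij := h.mem_confList i j ((accessConflict_append_iff he hnc).1 hij)

/-- The begin of a transaction. -/
theorem HistoryInvariant.append_beginTx (h : HistoryInvariant H c clock auOf th) (t : Fin n)
    (au : ℕ) (prog : AtomicUnit Obj Val) :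
    HistoryInvariant (H ++ [.beginTx clock au]) c (clock + 1) (Function.update auOf clock au)
      (Function.update th t (.exec au prog clock prog ∅ [])) := by
  have hlt : ∀ t' i, (th t').running? = some i → i < clock := by
    intro t' i hi
    have := h.exec t'
    cases hth : th t' <;> simp only [hth, ThreadState.running?, ThreadState.ExecOK,
      Option.some.injEq, reduceCtorEq] at hi this
    exact hi ▸ this.1.2
  -- All earlier events carry timestamps below `clock`, so the new transaction has no past.
  have hnc : ¬ Committed H clock := fun hc => (h.tx_mem _ hc).2.ne rfl
  have hne : ∀ t', (th t').running? ≠ some clock := fun t' ht' => (hlt t' _ ht').ne rfl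
  refine ⟨by omega, ?_, ?_, ?_, ?_, ?_, ?_, ?_, ?_, ?_⟩
  · intro e he
    rcases List.mem_append.1 he with he | he
    · have := h.tx_mem e he; omega
    · rw [List.mem_singleton.1 he]
      exact ⟨h.clock_pos, Nat.lt_succ_self _⟩
  · intro i h₁ h₂
    by_cases hi : i = clock
    · subst hi; simp
    · rw [Function.update_of_ne hi]
      exact List.mem_append_left _ (h.auOf i h₁ (by omega))
  · refine forall_update ⟨⟨h.clock_pos, Nat.lt_succ_self _⟩, ?_, ?_, ?_⟩ fun t' _ =>
      (h.exec t').append (Nat.le_succ _) (hne t')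
    · rwa [committed_append_iff (by simp)]
    · intro x
      simp only [Finset.notMem_empty, false_iff]
      rintro ⟨r, hr⟩
      simp only [List.mem_append, List.mem_singleton, reduceCtorEq, or_false] at hr
      exact (h.tx_mem _ hr).2.ne rfl
    · intro x
      simp only [writeSet, List.map_nil, List.toFinset_nil, Finset.notMem_empty, false_iff]
      rintro ⟨r, hr⟩
      simp only [List.mem_append, List.mem_singleton, reduceCtorEq, or_false] at hr
      exact (h.tx_mem _ hr).2.ne rfl
  · refine exec_inj_update h.exec_inj fun i t' _ hi => ?_
    obtain rfl : clock = i := by simpa [ThreadState.running?] using hi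
    exact hne t'
  · refine forall_update (Q := fun p : ThreadState Obj Val =>
      ∀ i, p.building? = some i → Committed (H ++ [.beginTx clock au]) i) ?_
      fun t' _ i hi => List.mem_append_left _ (h.building t' i hi)
    simp [ThreadState.building?]
  · intro i x
    rw [h.readersOf, committed_append_iff (by simp)]
    exact and_congr_right fun hi => by simp [Reads]
  · intro i x
    rw [h.writersOf, committed_append_iff (by simp)]
    exact and_congr_right fun hi => by simp [Writes]
  · exact fun i j hj => (h.of_mem_confList i j hj).append _
  · exact fun i j hij => h.mem_confList i j ((accessConflict_append_iff (by simp) hnc).1 hij)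

/-- A successful commit. -/
theorem HistoryInvariant.append_commit (h : HistoryInvariant H c clock auOf th) {t : Fin n}
    {i : ℕ} (ht : (th t).running? = some i) {rset wset : Finset Obj}
    (hpos : 1 ≤ i ∧ i < clock) (hnc : ¬ Committed H i) (hr : ∀ x, x ∈ rset ↔ Reads H i x)
    (hw : ∀ x, x ∈ wset ↔ Writes H i x) :
    HistoryInvariant (H ++ [.tryC i true]) (c.commit i rset wset) clock auOf
      (Function.update th t (.committed i)) := by
  -- The list is computed from the table before this commit, hence the condition that `T_j` is
  -- committed in `H`; this also keeps `i` out of its own list.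
  have hmem : ∀ j, j ∈ (c.commit i rset wset).confList i ↔ AccessConflict (H ++ [.tryC i true]) i j
      ∧ Committed H j := by
    intro j
    simp only [ConflictTable.commit, Function.update_self, Finset.mem_union, Finset.mem_biUnion,
      hr, hw, h.readersOf, h.writersOf]
    constructor
    · intro hj
      have hcj : Committed H j := by
        rcases hj with ⟨_, _, hj, _⟩ | ⟨_, _, ⟨hj, _⟩ | ⟨hj, _⟩⟩ <;> exact hj
      refine ⟨⟨?_, committed_append_tryC.2 (.inl rfl), committed_append_tryC.2 (.inr hcj), ?_⟩,
        hcj⟩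
      · rintro rfl; exact hnc hcj
      · simp only [writes_append_tryC, reads_append_tryC]
        rcases hj with ⟨x, h₁, _, h₂⟩ | ⟨x, h₁, ⟨_, h₂⟩ | ⟨_, h₂⟩⟩ <;> exact ⟨x, by tauto⟩
    · rintro ⟨⟨-, -, -, x, hx⟩, hcj⟩
      simp only [writes_append_tryC, reads_append_tryC] at hx
      rcases hx with ⟨h₁, h₂⟩ | ⟨h₁, h₂⟩ | ⟨h₁, h₂⟩
      · exact .inr ⟨x, h₁, .inl ⟨hcj, h₂⟩⟩
      · exact .inr ⟨x, h₁, .inr ⟨hcj, h₂⟩⟩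
      · exact .inl ⟨x, h₁, hcj, h₂⟩
  have hother : ∀ k, k ≠ i → (c.commit i rset wset).confList k = c.confList k := by
    intro k hk
    simp [ConflictTable.commit, hk]
  refine ⟨h.clock_pos, ?_, fun j h₁ h₂ => List.mem_append_left _ (h.auOf j h₁ h₂), ?_, ?_, ?_,
    ?_, ?_, ?_, ?_⟩
  · intro e he
    rcases List.mem_append.1 he with he | he
    · exact h.tx_mem e he
    · rw [List.mem_singleton.1 he]; exact hpos
  · refine forall_update (Q := fun p : ThreadState Obj Val => p.ExecOK (H ++ [.tryC i true]) clock)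
      ?_ fun t' ht' => ?_
    · trivial
    exact (h.exec t').append (e := .tryC i true) le_rfl fun hr => ht' (h.exec_inj t' t i hr ht)
  · exact exec_inj_update h.exec_inj fun k t' _ hk => by simp [ThreadState.running?] at hk
  · refine forall_update (Q := fun p : ThreadState Obj Val =>
      ∀ k, p.building? = some k → Committed (H ++ [.tryC i true]) k) ?_
      fun t' _ k hk => List.mem_append_left _ (h.building t' k hk)
    intro k hk
    obtain rfl : i = k := by simpa [ThreadState.building?] using hk
    exact committed_append_tryC.2 (.inl rfl)
  · intro k x
    rw [committed_append_tryC, reads_append_tryC]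
    simp only [ConflictTable.commit]
    have := h.readersOf k x
    have := hr x
    by_cases hk : k = i
    · subst hk; split_ifs <;> simp <;> tauto
    · split_ifs <;> simp [hk] <;> tauto
  · intro k x
    rw [committed_append_tryC, writes_append_tryC]
    simp only [ConflictTable.commit]
    have := h.writersOf k x
    have := hw x
    by_cases hk : k = i
    · subst hk; split_ifs <;> simp <;> tauto
    · split_ifs <;> simp [hk] <;> tauto
  · intro k j hj
    by_cases hk : k = i
    · subst hk; exact ((hmem j).1 hj).1
    · rw [hother k hk] at hj
      exact (h.of_mem_confList k j hj).append _
  · intro k j hkj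
    by_cases hk : k = i
    · subst hk
      exact .inl ((hmem j).2 ⟨hkj, (committed_append_tryC.1 hkj.right).resolve_left hkj.ne.symm⟩)
    by_cases hj : j = i
    · subst hj
      exact .inr ((hmem k).2 ⟨hkj.symm, (committed_append_tryC.1 hkj.left).resolve_left hkj.ne⟩)
    rw [hother k hk, hother j hj]
    refine h.mem_confList k j ⟨hkj.ne, (committed_append_tryC.1 hkj.left).resolve_left hk,
      (committed_append_tryC.1 hkj.right).resolve_left hj, ?_⟩
    simpa only [writes_append_tryC, reads_append_tryC] using hkj.access

theorem historyInvariant_initial :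
    HistoryInvariant ([] : List (Event Obj Val)) (ConflictTable.initial Obj) 1 (fun _ => 0)
      (fun _ : Fin n => .fetch) := by
  refine ⟨le_rfl, by simp, fun i _ _ => by omega, fun _ => trivial, ?_, ?_, ?_, ?_, ?_, ?_⟩
  · simp [ThreadState.running?]
  · simp [ThreadState.building?]
  · simp [ConflictTable.initial, Committed]
  · simp [ConflictTable.initial, Committed]
  · simp [ConflictTable.initial]
  · intro i j hij
    exact absurd hij.left (by simp [Committed])

end MinerInvariant

/-! ### Invariant of the graph: local knowledge of threads and outstanding edges. -/

section GraphInvariant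

variable {Obj : Type u} {Val : Type v}

/-- The local invariant of a thread that adds the conflicts of a transaction to the graph. -/
def ThreadState.GraphOK (G : BlockGraph) (H : List (Event Obj Val)) : ThreadState Obj Val → Prop
  | .loop i todo => ∀ k ∈ todo, AccessConflict H i k
  | .addVertJ i j todo w => (∀ k ∈ j :: todo, AccessConflict H i k) ∧
      LockFreeList.WindowOK G w
  | .addVertI i j todo aj w => (∀ k ∈ j :: todo, AccessConflict H i k) ∧ G.VertexAt aj j ∧
      LockFreeList.WindowOK G w
  | .addEdge i j todo a b w => (∀ k ∈ j :: todo, AccessConflict H i k) ∧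
      -- Here the window lies in the edge list of `a`; in the two `addVert` states it lies in the
      -- vertex list.
      G.VertexAt a (min i j) ∧ G.VertexAt b (max i j) ∧ (G.node a).data.edges.WindowOK w
  | .incCnt i _ todo b => (∀ k ∈ todo, AccessConflict H i k) ∧ G.Linked b
  | _ => True

theorem ThreadState.GraphOK.mono {G G' : BlockGraph} {H H' : List (Event Obj Val)}
    (hG : G.Extends G') (hH : ∀ i j, AccessConflict H i j → AccessConflict H' i j)
    {p : ThreadState Obj Val} (h : p.GraphOK G H) : p.GraphOK G' H' := by
  cases p with
  | loop i todo => exact fun k hk => hH _ _ (h k hk)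
  | addVertJ i j todo w => exact ⟨fun k hk => hH _ _ (h.1 k hk), h.2.mono hG.linked⟩
  | addVertI i j todo aj w =>
    exact ⟨fun k hk => hH _ _ (h.1 k hk), h.2.1.mono hG, h.2.2.mono hG.linked⟩
  | addEdge i j todo a b w =>
    exact ⟨fun k hk => hH _ _ (h.1 k hk), h.2.1.mono hG, h.2.2.1.mono hG,
      h.2.2.2.mono fun e he => (hG.edges a h.2.1.1 e he).1⟩
  | incCnt i j todo b => exact ⟨fun k hk => hH _ _ (h.1 k hk), hG.linked _ h.2⟩
  | _ => trivial

/-- The thread has still to add the edge between `T_i` and the member `k` of its conflict list. -/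
def ThreadState.Pending (i k : ℕ) : ThreadState Obj Val → Prop
  -- The list has not been fetched yet, so every entry counts as outstanding.
  | .committed i' => i' = i
  | .loop i' todo => i' = i ∧ k ∈ todo
  | .addVertJ i' j todo _ => i' = i ∧ k ∈ j :: todo
  | .addVertI i' j todo _ _ => i' = i ∧ k ∈ j :: todo
  | .addEdge i' j todo _ _ _ => i' = i ∧ k ∈ j :: todo
  -- The current edge is already in the graph; only its counter is missing.
  | .incCnt i' _ todo _ => i' = i ∧ k ∈ todo
  | _ => False

theorem ThreadState.Pending.building? {i k : ℕ} {p : ThreadState Obj Val} (h : p.Pending i k) :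
    p.building? = some i := by
  cases p <;> simp_all [Pending, ThreadState.building?]

/-- The vertices that the history justifies. -/
def VertexSpec (H : List (Event Obj Val)) (i au : ℕ) : Prop :=
  Committed H i ∧ Event.beginTx i au ∈ H

/-- The edges that the history justifies. -/
def EdgeSpec (H : List (Event Obj Val)) (i j : ℕ) : Prop := i < j ∧ AccessConflict H i j

theorem AccessConflict.edgeSpec {H : List (Event Obj Val)} {i j : ℕ} (h : AccessConflict H i j) :
    EdgeSpec H (min i j) (max i j) := by
  rcases lt_or_gt_of_ne h.ne with hlt | hlt
  · rw [min_eq_left hlt.le, max_eq_right hlt.le]; exact ⟨hlt, h⟩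
  · rw [min_eq_right hlt.le, max_eq_left hlt.le]; exact ⟨hlt, h.symm⟩

/-- The invariant of the block graph. -/
structure GraphInvariant {n : ℕ} (G : BlockGraph) (H : List (Event Obj Val))
    (c : ConflictTable Obj) (th : Fin n → ThreadState Obj Val) : Prop where
  safe : G.Safe (VertexSpec H) (EdgeSpec H)
  thread : ∀ t, (th t).GraphOK G H
  complete : ∀ i j, j ∈ c.confList i → G.HasEdge (min i j) (max i j) ∨ ∃ t, (th t).Pending i j

variable {n : ℕ} {G G' : BlockGraph} {H H' : List (Event Obj Val)}
  {c c' : ConflictTable Obj} {th : Fin n → ThreadState Obj Val}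

/-- Edges and local knowledge persist under `Extends`, and other threads keep their pending entries.
So a step owes only this: its own thread drops an entry only once the edge exists, and new list
entries are pending there. -/
theorem GraphInvariant.update (h : GraphInvariant G H c th) (hG : G.Extends G')
    (hS : G'.Safe (VertexSpec H') (EdgeSpec H'))
    (hH : ∀ i j, AccessConflict H i j → AccessConflict H' i j) {t : Fin n}
    {p : ThreadState Obj Val} (hp : p.GraphOK G' H')
    (hpend : ∀ i j, j ∈ c.confList i → (th t).Pending i j →
      p.Pending i j ∨ G'.HasEdge (min i j) (max i j))
    (hc : ∀ i j, j ∈ c'.confList i → j ∈ c.confList i ∨ p.Pending i j) :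
    GraphInvariant G' H' c' (Function.update th t p) where
  safe := hS
  thread := forall_update hp fun t' _ => (h.thread t').mono hG hH
  complete i j hj := by
    have hself : p.Pending i j → ∃ t', (Function.update th t p t').Pending i j :=
      fun hpp => ⟨t, by rwa [Function.update_self]⟩
    rcases hc i j hj with hj | hpp
    swap
    · exact .inr (hself hpp)
    rcases h.complete i j hj with he | ⟨t', ht'⟩
    · exact .inl (he.mono hG)
    by_cases htt : t' = t
    · subst htt
      rcases hpend i j hj ht' with hpp | he
      · exact .inr (hself hpp)
      · exact .inl he
    · exact .inr ⟨t', by rwa [Function.update_of_ne htt]⟩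

/-- A step that does not change the history. -/
theorem GraphInvariant.step (h : GraphInvariant G H c th) (hG : G.Extends G')
    (hS : G'.Safe (VertexSpec H) (EdgeSpec H)) {t : Fin n}
    {p : ThreadState Obj Val} (hp : p.GraphOK G' H)
    (hpend : ∀ i j, j ∈ c.confList i → (th t).Pending i j →
      p.Pending i j ∨ G'.HasEdge (min i j) (max i j)) :
    GraphInvariant G' H c (Function.update th t p) :=
  h.update hG hS (fun _ _ h => h) hp hpend fun _ _ h => .inl h

/-- A step that does not change the graph. -/
theorem GraphInvariant.goto (h : GraphInvariant G H c th) {t : Fin n}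
    {p : ThreadState Obj Val} (hp : p.GraphOK G H)
    (hpend : ∀ i j, j ∈ c.confList i → (th t).Pending i j → p.Pending i j) :
    GraphInvariant G H c (Function.update th t p) :=
  h.step (.refl G) h.safe hp fun i j hj ht => .inl (hpend i j hj ht)

theorem BlockGraph.Safe.append (h : G.Safe (VertexSpec H) (EdgeSpec H)) (e : Event Obj Val) :
    G.Safe (VertexSpec (H ++ [e])) (EdgeSpec (H ++ [e])) :=
  h.imp (fun _ _ h => ⟨List.mem_append_left _ h.1, List.mem_append_left _ h.2⟩)
    fun _ _ h => ⟨h.1, h.2.append e⟩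

/-- A step that appends an event to the history. -/
theorem GraphInvariant.append (h : GraphInvariant G H c th) (e : Event Obj Val) {t : Fin n}
    {p : ThreadState Obj Val} (hp : p.GraphOK G (H ++ [e]))
    (hpend : ∀ i j, ¬ (th t).Pending i j)
    (hc : ∀ i j, j ∈ c'.confList i → j ∈ c.confList i ∨ p.Pending i j) :
    GraphInvariant G (H ++ [e]) c' (Function.update th t p) :=
  h.update (.refl G) (h.safe.append e) (fun _ _ h => h.append e) hp
    (fun i j _ ht => absurd ht (hpend i j)) hc

end GraphInvariant

/-! ### Preservation of the combined invariant, and the theorem. -/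

section Main

variable {Obj : Type u} {Val : Type v} [DecidableEq Obj] {M : STM Obj Val} {n : ℕ}

/-- The invariant of the miner, for an invariant `I` of its transactional memory. -/
structure Miner.Invariant (I : M.State → List (Event Obj Val) → Prop) (s : Miner M n) : Prop where
  history : HistoryInvariant s.hist s.table s.clock s.auOf s.thread
  tm : I s.tm s.hist
  graph : GraphInvariant s.graph s.hist s.table s.thread

variable {I : M.State → List (Event Obj Val) → Prop}

theorem Miner.invariant_initial (hI : M.IsInvariant I) :
    (Miner.initial M n).Invariant I where
  history := historyInvariant_initial
  tm := hI.initial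
  graph := ⟨BlockGraph.safe_initial, fun _ => trivial, by
    simp [Miner.initial, ConflictTable.initial]⟩

theorem Miner.Invariant.execStep {s : Miner M n} (hI : M.IsInvariant I) (h : s.Invariant I)
    {t : Fin n} {au : ℕ} {prog : AtomicUnit Obj Val} {i : ℕ} {cont : AtomicUnit Obj Val}
    {rset : Finset Obj} {wlog : List (Obj × Val)}
    (ht : s.thread t = .exec au prog i cont rset wlog) :
    (s.execStep t au prog i cont rset wlog).Invariant I := by
  obtain ⟨hh, htm, hg⟩ := h
  have hrun : (s.thread t).running? = some i := by rw [ht]; rfl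
  have hpend : ∀ k j, ¬ (s.thread t).Pending k j := by
    intro k j; rw [ht]; exact id
  obtain ⟨hpos, hnc, hr, hw⟩ : (ThreadState.exec au prog i cont rset wlog).ExecOK s.hist s.clock :=
    ht ▸ hh.exec t
  have hlocal : ∀ next, (s.goto t (.exec au prog i next rset wlog)).Invariant I := fun next =>
    ⟨hh.goto t (.inr hrun.symm) ⟨hpos, hnc, hr, hw⟩ (by simp [ThreadState.building?]), htm,
      hg.goto trivial fun k j _ hk => absurd hk (hpend k j)⟩
  -- Covers all events of a running transaction except the successful commit, the only one that
  -- changes the conflict table.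
  have happ : ∀ (e : Event Obj Val) (σ : M.State) (p : ThreadState Obj Val), e.tx = i →
      (∀ k, e ≠ .tryC k true) → I σ (s.hist ++ [e]) →
      (p.running? = none ∨ p.running? = some i) → p.ExecOK (s.hist ++ [e]) s.clock →
      p.building? = none → p.GraphOK s.graph (s.hist ++ [e]) →
      ({ s with tm := σ, hist := s.hist ++ [e] }.goto t p).Invariant I := by
    rintro e σ p rfl he hσ hp₁ hp₂ hp₃ hp₄
    exact ⟨hh.append hrun he hnc hpos hp₁ hp₂ hp₃, hσ,
      hg.append e hp₄ hpend fun _ _ h => .inl h⟩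
  unfold Miner.execStep
  cases cont with
  | skip next => exact hlocal next
  | write x w next =>
    refine happ (.write i x w) s.tm _ rfl (by simp) (hI.write _ _ _ _ _ htm hnc) (.inr rfl) ?_ rfl
      trivial
    refine ⟨hpos, by rwa [committed_append_iff (by simp)], fun y => ?_, fun y => ?_⟩
    · rw [reads_append_write, hr]
    · rw [writes_append_write, writeSet_cons, hw]
  | read x next =>
    dsimp only
    cases hl : wlog.lookup x with
    | some w => exact hlocal (next w)
    | none =>
      dsimp only
      have hread := hI.read _ _ _ x htm hpos.1
      generalize M.read s.tm i x = r at hread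
      obtain ⟨σ, _ | ⟨j, w⟩⟩ := r
      · exact happ (.read i x none) σ _ rfl (by simp) hread (.inl rfl) trivial rfl trivial
      · refine happ (.read i x (some (j, w))) σ _ rfl (by simp) hread (.inr rfl) ?_ rfl trivial
        refine ⟨hpos, by rwa [committed_append_iff (by simp)], fun y => ?_, fun y => ?_⟩
        · rw [reads_append_read_some, Finset.mem_insert, hr]
        · rw [writes_append_read, hw]
  | ret =>
    dsimp only
    have htryC := hI.tryC _ _ _ wlog htm hnc hw
    generalize M.tryC s.tm i wlog = r at htryC
    obtain ⟨σ, _ | _⟩ := r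
    · exact happ (.tryC i false) σ _ rfl (by simp) htryC (.inl rfl) trivial rfl trivial
    · refine ⟨hh.append_commit hrun hpos hnc hr hw, htryC, hg.append _ trivial hpend ?_⟩
      intro k j hj
      by_cases hk : k = i
      -- The fresh entries all belong to `T_i`, whose thread is now in state `committed i`, where
      -- each of them is pending.
      · exact .inr hk.symm
      · left
        change j ∈ Function.update s.table.confList i _ k at hj
        rwa [Function.update_of_ne hk] at hj

theorem Miner.Invariant.step {s : Miner M n} (hI : M.IsInvariant I) (h : s.Invariant I)
    (aus : List (AtomicUnit Obj Val)) (t : Fin n) : (s.step aus t).Invariant I := by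
  have hgraph := h.graph.thread t
  have hbuild := h.history.building t
  -- No invariant mentions `curInd`, so one statement serves the fetch and all graph-building steps.
  have hgoto : ∀ (G : BlockGraph) (m : ℕ) (p : ThreadState Obj Val), p.running? = none →
      (p.building? = none ∨ p.building? = (s.thread t).building?) →
      GraphInvariant G s.hist s.table (Function.update s.thread t p) →
      ({ s with graph := G, curInd := m }.goto t p).Invariant I :=
    fun G m p h₁ h₂ h₃ => ⟨h.history.goto_building t h₁ h₂, h.tm, h₃⟩
  have hpend : ∀ p, s.thread t = p → ∀ i j, (s.thread t).Pending i j → p.Pending i j := by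
    rintro p rfl i j h; exact h
  unfold Miner.step
  cases ht : s.thread t with
  | fetch =>
    replace hpend := hpend _ ht
    dsimp only
    refine hgoto s.graph _ _ ?_ (.inl ?_) (h.graph.goto ?_ fun i j _ hp => (hpend i j hp).elim)
    all_goals cases aus[s.curInd]? <;> first | rfl | trivial
  | beginTx au prog =>
    replace hpend := hpend _ ht
    exact ⟨h.history.append_beginTx t au prog, hI.beginTx _ _ _ _ h.tm,
      h.graph.append _ trivial hpend fun _ _ h => .inl h⟩
  | exec au prog i cont rset wlog => exact h.execStep hI ht
  | committed i =>
    replace hpend := hpend _ ht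
    dsimp only
    split_ifs with hemp
    · refine hgoto s.graph s.curInd _ rfl (.inl rfl) (h.graph.goto trivial fun k j hj hp => ?_)
      obtain rfl : i = k := hpend k j hp
      simp [hemp] at hj
    · refine hgoto s.graph s.curInd _ rfl (.inr (by rw [ht]; rfl)) (h.graph.goto ?_ ?_)
      -- Here the knowledge that each entry is a true conflict passes from the table to the thread.
      · exact fun k hk => h.history.of_mem_confList i k ((Finset.mem_sort _).1 hk)
      · intro k j hj hp
        obtain rfl : i = k := hpend k j hp
        exact ⟨rfl, (Finset.mem_sort _).2 hj⟩
  | loop i todo =>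
    replace hpend := hpend _ ht
    rw [ht] at hgraph
    cases todo with
    | nil =>
      refine hgoto s.graph s.curInd _ rfl (.inl rfl) (h.graph.goto trivial fun k j _ hp => ?_)
      exact absurd (hpend k j hp).2 List.not_mem_nil
    | cons j todo =>
      exact hgoto s.graph s.curInd _ rfl (.inr (by rw [ht]; rfl))
        (h.graph.goto ⟨hgraph, LockFreeList.windowOK_start _⟩ fun k l _ hp => hpend k l hp)
  | addVertJ i j todo w =>
    replace hpend := hpend _ ht
    rw [ht] at hgraph
    obtain ⟨hconf, hw⟩ := hgraph
    have hj : Committed s.hist j := (hconf j List.mem_cons_self).right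
    obtain ⟨hle, hsafe, hres⟩ := BlockGraph.addVertStep_spec h.graph.safe
      (au := s.auOf j) ⟨hj, h.history.beginTx_mem hj⟩ hw
    dsimp only
    generalize s.graph.addVertStep j (s.auOf j) w = r at *
    obtain ⟨G', w' | a | a⟩ := r
    · exact hgoto G' s.curInd _ rfl (.inr (by rw [ht]; rfl))
        (h.graph.step hle hsafe ⟨hconf, hres⟩ fun k l _ hp => .inl (hpend k l hp))
    all_goals
      exact hgoto G' s.curInd _ rfl (.inr (by rw [ht]; rfl))
        (h.graph.step hle hsafe ⟨hconf, hres, LockFreeList.windowOK_start _⟩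
          fun k l _ hp => .inl (hpend k l hp))
  | addVertI i j todo aj w =>
    replace hpend := hpend _ ht
    rw [ht] at hgraph
    obtain ⟨hconf, haj, hw⟩ := hgraph
    have hij := hconf j List.mem_cons_self
    have hi : Committed s.hist i := hij.left
    obtain ⟨hle, hsafe, hres⟩ := BlockGraph.addVertStep_spec h.graph.safe
      (au := s.auOf i) ⟨hi, h.history.beginTx_mem hi⟩ hw
    replace haj := haj.mono hle
    dsimp only
    generalize s.graph.addVertStep i (s.auOf i) w = r at *
    obtain ⟨G', w' | a | a⟩ := r
    · exact hgoto G' s.curInd _ rfl (.inr (by rw [ht]; rfl))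
        (h.graph.step hle hsafe ⟨hconf, haj, hres⟩ fun k l _ hp => .inl (hpend k l hp))
    all_goals
      dsimp only
      split_ifs with hlt
      · refine hgoto G' s.curInd _ rfl (.inr (by rw [ht]; rfl))
          (h.graph.step hle hsafe ⟨hconf, ?_, ?_, LockFreeList.windowOK_start _⟩
            fun k l _ hp => .inl (hpend k l hp))
        · rwa [min_eq_right hlt.le]
        · rw [max_eq_left hlt.le]; exact hres
      · rw [not_lt] at hlt
        refine hgoto G' s.curInd _ rfl (.inr (by rw [ht]; rfl))
          (h.graph.step hle hsafe ⟨hconf, ?_, ?_, LockFreeList.windowOK_start _⟩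
            fun k l _ hp => .inl (hpend k l hp))
        · rw [min_eq_left hlt]; exact hres
        · rwa [max_eq_right hlt]
  | addEdge i j todo a b w =>
    replace hpend := hpend _ ht
    rw [ht] at hgraph
    obtain ⟨hconf, ha, hb, hw⟩ := hgraph
    have hij := hconf j List.mem_cons_self
    have htodo : ∀ k ∈ todo, AccessConflict s.hist i k :=
      fun k hk => hconf k (List.mem_cons_of_mem _ hk)
    obtain ⟨hle, hsafe, hres⟩ := BlockGraph.addEdgeStep_spec h.graph.safe ha hb hij.edgeSpec hw
    replace ha := ha.mono hle
    replace hb := hb.mono hle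
    dsimp only
    generalize s.graph.addEdgeStep a b w = r at *
    -- Whether the edge node was found or inserted, it is linked with the right key, and safety
    -- supplies its target; so `j` may leave the pending entries.
    have hdone : (∀ w', r.2 ≠ .again w') → r.1.HasEdge (min i j) (max i j) := by
      intro hne
      obtain ⟨G', w' | e | e⟩ := r
      · exact absurd rfl (hne w')
      all_goals exact hsafe.hasEdge ha hres
    have hnext : (∀ w', r.2 ≠ .again w') → ∀ k l, (s.thread t).Pending k l →
        (i = k ∧ l ∈ todo) ∨ r.1.HasEdge (min k l) (max k l) := by
      intro hne k l hp
      obtain ⟨rfl, hl⟩ := hpend k l hp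
      rcases List.mem_cons.1 hl with rfl | hl
      · exact .inr (hdone hne)
      · exact .inl ⟨rfl, hl⟩
    obtain ⟨G', w' | e | e⟩ := r
    · exact hgoto G' s.curInd _ rfl (.inr (by rw [ht]; rfl))
        (h.graph.step hle hsafe ⟨hconf, ha, hb, hres⟩ fun k l _ hp => .inl (hpend k l hp))
    · exact hgoto G' s.curInd _ rfl (.inr (by rw [ht]; rfl))
        (h.graph.step hle hsafe htodo fun k l _ hp => hnext (by simp) k l hp)
    · exact hgoto G' s.curInd _ rfl (.inr (by rw [ht]; rfl))
        (h.graph.step hle hsafe ⟨htodo, hb.1⟩ fun k l _ hp => hnext (by simp) k l hp)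
  | incCnt i j todo b =>
    replace hpend := hpend _ ht
    rw [ht] at hgraph
    obtain ⟨hle, hsafe⟩ := BlockGraph.incInCnt_spec h.graph.safe hgraph.2
    exact hgoto _ s.curInd _ rfl (.inr (by rw [ht]; rfl))
      (h.graph.step hle hsafe hgraph.1 fun k l _ hp => .inl (hpend k l hp))
  | finished => exact h

theorem Miner.Reachable.invariant (hI : M.IsInvariant I) {aus : List (AtomicUnit Obj Val)}
    {s : Miner M n} (hs : Miner.Reachable aus s) : s.Invariant I := by
  induction hs with
  | initial => exact Miner.invariant_initial hI
  | step t _ ih => exact ih.step hI aus t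

/-- One of the two transactions lists the other. A pending entry would mean that some thread is
still building the owner of that list. -/
theorem Miner.Invariant.hasEdge {s : Miner M n} (h : s.Invariant I) {i j : ℕ}
    (hij : AccessConflict s.hist i j) (hi : ¬ s.Building i) (hj : ¬ s.Building j) :
    s.graph.HasEdge (min i j) (max i j) := by
  rcases h.history.mem_confList i j hij with hm | hm
  · exact (h.graph.complete i j hm).resolve_right fun ⟨t, ht⟩ => hi ⟨t, ht.building?⟩
  · rw [min_comm, max_comm]
    exact (h.graph.complete j i hm).resolve_right fun ⟨t, ht⟩ => hj ⟨t, ht.building?⟩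

end Main

theorem theorem3 {Obj : Type u} {Val : Type v} [DecidableEq Obj] (P : Protocol) (x₀ : Obj → Val)
    (n : ℕ) (aus : List (AtomicUnit Obj Val)) (s : Miner (P.stm x₀) n)
    (hs : Miner.Reachable aus s) :
    -- the vertices are committed transactions, labelled with the atomic-units they execute
    (∀ a i, s.graph.VertexAt a i →
      Committed s.hist i ∧ Event.beginTx i (s.graph.node a).data.auId ∈ s.hist) ∧
    -- every edge points from the lower to the higher timestamp, and stands for a conflict
    (∀ a e i j, s.graph.VertexAt a i → s.graph.EdgeAt a e j →
      i < j ∧ s.graph.VertexAt (s.graph.target a e) j ∧ Conflicting s.hist i j) ∧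
    -- every conflict between transactions whose graph construction is over is captured
    (∀ i j, Conflicting s.hist i j → ¬ s.Building i → ¬ s.Building j →
      s.graph.HasEdge (min i j) (max i j)) ∧
    -- every dependency is captured, in its own direction
    (∀ k m, Dependency P s.hist k m → ¬ s.Building k → ¬ s.Building m →
      k < m ∧ s.graph.HasEdge k m) ∧
    -- the final graph consists of exactly the conflicts, directed by the timestamps
    (s.Finished → ∀ i j, s.graph.HasEdge i j ↔ i < j ∧ Conflicting s.hist i j) := by
  obtain ⟨I, hI, hdep⟩ := P.exists_isInvariant x₀
  have h := hs.invariant hI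
  have hedge : ∀ a e i j, s.graph.VertexAt a i → s.graph.EdgeAt a e j →
      i < j ∧ s.graph.VertexAt (s.graph.target a e) j ∧ Conflicting s.hist i j := by
    intro a e i j ha he
    obtain ⟨⟨h₁, h₂⟩, h₃⟩ := h.graph.safe.edge a e i j ha he
    exact ⟨h₁, h₃, conflicting_iff_accessConflict.2 h₂⟩
  refine ⟨h.graph.safe.vertex, hedge, ?_, ?_, ?_⟩
  · exact fun i j hij => h.hasEdge (conflicting_iff_accessConflict.1 hij)
  · intro k m hd hk hm
    obtain ⟨hlt, hc⟩ := hdep _ _ h.tm (fun _ => h.history.committed_pos) k m hd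
    have := h.hasEdge hc hk hm
    rw [min_eq_left hlt.le, max_eq_right hlt.le] at this
    exact ⟨hlt, this⟩
  · intro hfin i j
    -- Finished threads build nothing, so completeness applies to every conflict.
    have hnb : ∀ k, ¬ s.Building k := by
      rintro k ⟨t, ht⟩
      simp [hfin t, ThreadState.building?] at ht
    constructor
    · rintro ⟨a, e, ha, he, -⟩
      exact ⟨(hedge a e i j ha he).1, (hedge a e i j ha he).2.2⟩
    · rintro ⟨hlt, hc⟩
      have := h.hasEdge (conflicting_iff_accessConflict.1 hc) (hnb i) (hnb j)
      rwa [min_eq_left hlt.le, max_eq_right hlt.le] at this
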